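/- Let $0<H<1$ and let $B^H=(B^H_t)_{t\ge 0}$ be a fractional Brownian motion with Hurst parameter $H$ on a probability space, i.e. a centered Gaussian process with almost surely continuous paths and $\mathbb E[B^H_tB^H_s]=\frac12\left(t^{2H}+s^{2H}-|t-s|^{2H}\right)$. Let $T>0$ and let $\sigma=(\sigma_t)_{0\le t\le T}$ be a stochastic process, not necessarily adapted, whose paths are almost surely Hölder continuous on $[0,T]$ of some order greater than $1-H$. Let $I_t=\int_0^t\sigma_s\,dB^H_s$, $0\le t\le T$, be the pathwise limit of Riemann–Stieltjes sums, which exists almost surely for all $t\in[0,T]$, continued by $I_t=0$ for $t<0$ and $I_t=I_T$ for $t>T$. Let $\psi:\mathbb R\to\mathbb R$ be integrable with compact support, not almost everywhere zero, with $\int t^m\psi(t)\,dt=0$ for $0\le m<p$, for some integer $p\ge 1$. Let $N\ge 1$ be an integer, and for $j,k\in\mathbb Z$ put $$d_j(k)=2^{-j/2}\int_{\mathbb R}\psi(2^{-j}t-k)\,I_t\,dt,\qquad S_j=\frac{1}{N/2^j}\sum_{k=1}^{\lfloor N/2^j\rfloor}d_j(k)^2$$ (so $S_j=0$, the sum being empty,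 when $j>\log_2N$). Then: 1. There are random variables $C_\gamma\in(0,\infty)$, $\gamma<H$, such that almost surely $$S_j\le C_\gamma\,2^{j(2\gamma+1)}\qquad\text{for all } j\in\mathbb Z\text{ and all }\gamma<H.$$ 2. Almost surely on the event that $\sigma$ does not vanish identically on $[0,\min(T,N)]$: for every $\gamma>H$ and every constant $c$, the inequality $S_j\le c\,2^{j(2\gamma+1)}$ fails for infinitely many negative integers $j$; moreover $S_j>0$ for all sufficiently negative $j$, and $$\liminf_{j\to-\infty}\frac{\log_2 S_j}{j}=2H+1 .$$ -/

import Mathlib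

open MeasureTheory ProbabilityTheory Filter Set
open scoped NNReal

/-- `B` is a fractional Brownian motion with Hurst parameter `H`: a centered Gaussian process on
`[0, ∞)` with covariance `(t^{2H} + s^{2H} - |t - s|^{2H}) / 2` and almost surely continuous
paths. (Stationarity of the increments and `B 0 = 0` a.s. follow from mean and covariance.) -/
structure IsFractionalBrownianMotion {Ω : Type*} [MeasurableSpace Ω] (H : ℝ) (B : ℝ≥0 → Ω → ℝ)
    (P : Measure Ω) : Prop where
  gaussian : IsGaussianProcess B P
  centered : ∀ t, ∫ ω, B t ω ∂P = 0
  covariance : ∀ s t : ℝ≥0, ∫ ω, B t ω * B s ω ∂P =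
    ((t : ℝ) ^ (2 * H) + (s : ℝ) ^ (2 * H) - |(t : ℝ) - (s : ℝ)| ^ (2 * H)) / 2
  continuous_paths : ∀ᵐ ω ∂P, Continuous fun t => B t ω

/-- `I` is the Riemann-Stieltjes integral of `f` against `g` over `[a, b]` (for `a ≤ b`): the limit
of the sums `∑ f (ξ i) (g (t (i+1)) - g (t i))` as the mesh of the tagged partition
`a = t 0 ≤ ξ 0 ≤ t 1 ≤ ξ 1 ≤ ⋯ ≤ t n = b` tends to `0`. -/
def IsRiemannStieltjesIntegral (f g : ℝ → ℝ) (a b I : ℝ) : Prop :=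
  ∀ ε > 0, ∃ δ > 0, ∀ (n : ℕ) (t ξ : ℕ → ℝ), t 0 = a → t n = b →
    (∀ i < n, t i ≤ ξ i ∧ ξ i ≤ t (i + 1) ∧ t (i + 1) - t i < δ) →
    |∑ i ∈ Finset.range n, f (ξ i) * (g (t (i + 1)) - g (t i)) - I| < ε

open Classical in
/-- The Riemann-Stieltjes integral of `f` against `g` over `[a, b]`, for `a ≤ b`
(with value `0` if the sums do not converge). -/
noncomputable def riemannStieltjesIntegral (f g : ℝ → ℝ) (a b : ℝ) : ℝ :=
  if h : ∃ I, IsRiemannStieltjesIntegral f g a b I then h.choose else 0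

/-- The pathwise integral `I_t = ∫_0^t σ_s dB_s`, `0 ≤ t ≤ T`, continued to all real times by its
end values: `I_t = 0` for `t < 0` and `I_t = I_T` for `t > T`. -/
noncomputable def pathwiseIntegral {Ω : Type*} (σ : ℝ → Ω → ℝ) (B : ℝ≥0 → Ω → ℝ) (T : ℝ)
    (t : ℝ) (ω : Ω) : ℝ :=
  riemannStieltjesIntegral (fun s => σ s ω) (fun s => B s.toNNReal ω) 0 (min (max t 0) T)

/-- `ψ` has `p` vanishing moments: `∫ t^k ψ(t) dt = 0` for `0 ≤ k < p`. -/
def HasVanishingMoments (ψ : ℝ → ℝ) (p : ℕ) : Prop :=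
  ∀ k < p, ∫ t : ℝ, t ^ k * ψ t = 0

/-- The detail coefficient of `Z` at scale `j` and shift `k`:
`d_j(k) = 2^{-j/2} ∫ ψ(2^{-j} t - k) Z(t) dt`. -/
noncomputable def detailCoeff (ψ Z : ℝ → ℝ) (j k : ℤ) : ℝ :=
  (2 : ℝ) ^ (-(j : ℝ) / 2) * ∫ t : ℝ, ψ ((2 : ℝ) ^ (-j) * t - k) * Z t

/-- The scale spectrum of `Z` with `N` initial coefficients:
`S_j = (N / 2^j)⁻¹ ∑_{k = 1}^{N / 2^j} d_j(k)^2`. The upper limit is rounded down; in particular the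
sum is empty when `j > log₂ N`. -/
noncomputable def scaleSpectrum (ψ Z : ℝ → ℝ) (N : ℕ) (j : ℤ) : ℝ :=
  1 / ((N : ℝ) / (2 : ℝ) ^ j) *
    ∑ k ∈ Finset.Icc 1 ⌊(N : ℝ) / (2 : ℝ) ^ j⌋₊, detailCoeff ψ Z j (k : ℤ) ^ 2

/-!
Write `r = 2 ^ j`. In the coordinate `u = t / r - k` the detail coefficient of `I` is
`r ^ (1/2) ∫ ψ(u) I(r k + r u) du` (`detailCoeff_eq`), and because `∫ ψ = 0` only the increments of
`I` over distances of order `r` matter.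

The paths of `B` are Hölder continuous of every order below `H` (moments of the dyadic increments
and chaining). Since those of `σ` are so of an order greater than `1 - H`, the two orders can be
taken to add up to some `θ > 1`, and summation along dyadic grids (`exists_sewing`) gives a
function `F` with `F_t - F_s = σ_s (B_t - B_s) + O(|t - s| ^ θ)`. As `θ > 1`, the sum of
these errors over a partition vanishes with the mesh, so `F` is the Riemann-Stieltjes integral `I`. In particular `I`
is Hölder continuous of every order below `H`, which is the upper bound. Its random constant is
the Hölder constant of `I`, a supremum over rational times and therefore measurable.

For the lower bound, `∫ ψ(u) B(x + r u) du` is a limit of centered Gaussian variables whose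
variances converge to `r ^ (2H)` times the energy `-1/2 ∫∫ ψ(u) ψ(v) |u - v| ^ (2H) du dv`. The
energy is positive: it is a positive multiple of `∫ |ψ̂(ξ)|² |ξ| ^ (-1-2H) dξ` (`fbmEnergy_pos`).
The density of a Gaussian variable is bounded, so the integral is below `r ^ (H + ε)` with
probability `O(r ^ ε)` (`IsFractionalBrownianMotion.measure_abs_integral_lt_le`). This is summable
over the scales, and by Markov's inequality applied to the number of small coefficients and the
Borel-Cantelli lemma, almost surely, at all fine scales, at least half of the coefficients of `B`
located in a given interval `[a, b]` are at least `r ^ (1/2 + H + ε)`; no decorrelation of the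
coefficients is needed. On an interval where `|σ|` is bounded away from zero the coefficients of
`I` are those of `B` times `σ`, up to `O(r ^ (1/2 + θ))` with `θ > 1 > H + ε`; adaptedness of `σ`
plays no role. Hence `S_j` is at least a constant times `2 ^ (j (2 (H + ε) + 1))` for all
sufficiently negative `j` (`exists_le_scaleSpectrum`), and together with the upper bound this
determines the exponent (`scaling_of_bounds`).
-/

/-! ### The Young integral -/

/-- The left-point Riemann sum of `f` against `g` over `[0, t]` along the grid of mesh `h`, the last
cell being cut off at `t`. -/
noncomputable def gridSum (f g : ℝ → ℝ) (h t : ℝ) : ℝ :=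
  ∑ i ∈ Finset.range ⌊t / h⌋₊, f (i * h) * (g ((i + 1) * h) - g (i * h)) +
    f (⌊t / h⌋₊ * h) * (g t - g (⌊t / h⌋₊ * h))

lemma gridSum_eq_of_mem {f g : ℝ → ℝ} {h t : ℝ} (hh : 0 < h) {m : ℕ} (h1 : m * h ≤ t)
    (h2 : t ≤ (m + 1) * h) :
    gridSum f g h t =
      ∑ i ∈ Finset.range m, f (i * h) * (g ((i + 1) * h) - g (i * h)) +
        f (m * h) * (g t - g (m * h)) := by
  rcases h2.lt_or_eq with h3 | h3
  · have : ⌊t / h⌋₊ = m := by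
      rw [Nat.floor_eq_iff (by rw [le_div_iff₀ hh]; nlinarith [(Nat.cast_nonneg m : (0:ℝ) ≤ m)])]
      exact ⟨by rwa [le_div_iff₀ hh], by rwa [div_lt_iff₀ hh]⟩
    rw [gridSum, this]
  · have : ⌊t / h⌋₊ = m + 1 := by
      rw [h3, mul_div_cancel_right₀ _ hh.ne']
      exact_mod_cast Nat.floor_natCast (R := ℝ) (m + 1)
    rw [gridSum, this, Finset.sum_range_succ, h3]
    push_cast
    ring

lemma gridSum_zero {f g : ℝ → ℝ} {h : ℝ} : gridSum f g h 0 = 0 := by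
  simp [gridSum]

lemma gridSum_grid {f g : ℝ → ℝ} {h : ℝ} (hh : 0 < h) (m : ℕ) :
    gridSum f g h (m * h) =
      ∑ i ∈ Finset.range m, f (i * h) * (g ((i + 1) * h) - g (i * h)) := by
  rw [gridSum_eq_of_mem hh le_rfl (by nlinarith)]
  simp

/-- Within a cell, halving the mesh changes the increment of the grid sum by at most one term of
order `h ^ (α + γ)`. -/
lemma abs_gridSum_halve_sub_le {f g : ℝ → ℝ} {α γ K L : ℝ} (hα : 0 ≤ α) (hγ : 0 ≤ γ)
    (hK : 0 ≤ K) (hL : 0 ≤ L)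
    (hf : ∀ s t, |f t - f s| ≤ K * |t - s| ^ α) (hg : ∀ s t, |g t - g s| ≤ L * |t - s| ^ γ)
    {h : ℝ} (hh : 0 < h) {m : ℕ} {t : ℝ} (h1 : m * h ≤ t) (h2 : t ≤ (m + 1) * h) :
    |(gridSum f g (h / 2) t - gridSum f g h t) -
      (gridSum f g (h / 2) (m * h) - gridSum f g h (m * h))| ≤ K * L * h ^ (α + γ) := by
  have e0 : (m : ℝ) * h = ((2 * m : ℕ) : ℝ) * (h / 2) := by push_cast; ring
  have hh2 : 0 < h / 2 := by positivity
  rw [gridSum_eq_of_mem hh h1 h2, gridSum_grid hh]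
  have e2 := gridSum_grid (f := f) (g := g) hh2 (2 * m)
  rw [← e0] at e2
  rw [e2]
  rcases le_total t ((2 * m + 1 : ℝ) * (h / 2)) with h3 | h3
  · rw [gridSum_eq_of_mem hh2 (m := 2 * m) (by rw [← e0]; exact h1) (by push_cast; exact h3), ← e0]
    have : ∀ a b c : ℝ, a + c - (b + c) - (a - b) = 0 := by intros; ring
    rw [this, abs_zero]
    positivity
  · rw [gridSum_eq_of_mem hh2 (m := 2 * m + 1) (by push_cast; exact h3)
      (by push_cast; nlinarith), Finset.sum_range_succ, ← e0]
    have e1 : ∀ a b : ℝ, a + f (m * h) * (g (((2 * m : ℕ) + 1) * (h / 2)) - g (m * h)) +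
        f ((2 * m + 1 : ℕ) * (h / 2)) * (g t - g ((2 * m + 1 : ℕ) * (h / 2))) -
        (b + f (m * h) * (g t - g (m * h))) - (a - b) =
        (f ((2 * m + 1 : ℕ) * (h / 2)) - f (m * h)) * (g t - g ((2 * m + 1 : ℕ) * (h / 2))) := by
      intro a b; push_cast; ring
    rw [e1, abs_mul, Real.rpow_add hh]
    have b1 : |f ((2 * m + 1 : ℕ) * (h / 2)) - f (m * h)| ≤ K * h ^ α := by
      refine (hf _ _).trans ?_
      gcongr
      rw [abs_le]; push_cast; constructor <;> nlinarith
    have b2 : |g t - g ((2 * m + 1 : ℕ) * (h / 2))| ≤ L * h ^ γ := by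
      refine (hg _ _).trans ?_
      gcongr
      rw [abs_le]; push_cast; constructor <;> nlinarith
    calc _ ≤ (K * h ^ α) * (L * h ^ γ) := by gcongr
      _ = _ := by ring

/-- If the increments of `G` inside each cell of the grid of mesh `h` are at most `c`, its increment
over `[s, t]` is at most `c` times the number of cells met. -/
lemma abs_sub_le_of_cells {G : ℝ → ℝ} {h c : ℝ} (hh : 0 < h)
    (hG : ∀ (m : ℕ) (t : ℝ), m * h ≤ t → t ≤ (m + 1) * h → |G t - G (m * h)| ≤ c)
    {s t : ℝ} (hs : 0 ≤ s) (hst : s ≤ t) : |G t - G s| ≤ c * ((t - s) / h + 3) := by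
  have hc : 0 ≤ c := (abs_nonneg _).trans (hG 0 0 (by simp) (by simpa using hh.le))
  have grid : ∀ m k : ℕ, |G ((m + k : ℕ) * h) - G (m * h)| ≤ k * c := by
    intro m k
    induction k with
    | zero => simp
    | succ k ih =>
      have := hG (m + k) ((m + (k + 1) : ℕ) * h) (by push_cast; nlinarith) (by push_cast; nlinarith)
      calc _ ≤ |G ((m + (k + 1) : ℕ) * h) - G ((m + k : ℕ) * h)| +
            |G ((m + k : ℕ) * h) - G (m * h)| := abs_sub_le _ _ _
        _ ≤ c + k * c := add_le_add this ih
        _ = _ := by push_cast; ring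
  have cell : ∀ t, 0 ≤ t → |G t - G (⌊t / h⌋₊ * h)| ≤ c := by
    intro t ht
    refine hG _ _ ?_ ?_
    · rw [← le_div_iff₀ hh]; exact Nat.floor_le (by positivity)
    · rw [← div_le_iff₀ hh]; exact (Nat.lt_floor_add_one _).le
  obtain ⟨k, hk⟩ := Nat.exists_eq_add_of_le
    (Nat.floor_le_floor (div_le_div_of_nonneg_right hst hh.le))
  have hk' : (k : ℝ) ≤ (t - s) / h + 1 := by
    have a1 := Nat.floor_le (div_nonneg (hs.trans hst) hh.le)
    have a2 := Nat.lt_floor_add_one (s / h)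
    have a3 : (⌊t / h⌋₊ : ℝ) = ⌊s / h⌋₊ + k := by exact_mod_cast hk
    rw [sub_div]; linarith
  have b1 := cell t (hs.trans hst)
  have b2 := cell s hs
  have b3 := grid ⌊s / h⌋₊ k
  rw [← hk] at b3
  rw [abs_sub_comm] at b2
  have : |G t - G s| ≤ c + (k * c + c) :=
    (abs_sub_le _ (G (⌊t / h⌋₊ * h)) _).trans
      (add_le_add b1 ((abs_sub_le _ (G (⌊s / h⌋₊ * h)) _).trans (add_le_add b3 b2)))
  nlinarith

/-- Over an interval not longer than the mesh, the grid sum is close to a single product. -/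
lemma abs_gridSum_sub_sub_le {f g : ℝ → ℝ} {α γ K L : ℝ} (hα : 0 ≤ α) (hγ : 0 ≤ γ)
    (hK : 0 ≤ K) (hL : 0 ≤ L)
    (hf : ∀ s t, |f t - f s| ≤ K * |t - s| ^ α) (hg : ∀ s t, |g t - g s| ≤ L * |t - s| ^ γ)
    {h : ℝ} (hh : 0 < h) {s t : ℝ} (hs : 0 ≤ s) (hst : s ≤ t) (hth : t - s ≤ h) :
    |gridSum f g h t - gridSum f g h s - f s * (g t - g s)| ≤ 2 * (K * L * h ^ (α + γ)) := by
  have prod : ∀ x y z w, |x - y| ≤ h → |z - w| ≤ h →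
      |(f x - f y) * (g z - g w)| ≤ K * L * h ^ (α + γ) := by
    intro x y z w h1 h2
    rw [abs_mul, Real.rpow_add hh]
    calc _ ≤ (K * h ^ α) * (L * h ^ γ) := by
          refine mul_le_mul ((hf _ _).trans ?_) ((hg _ _).trans ?_) (abs_nonneg _) (by positivity)
            <;> gcongr
      _ = _ := by ring
  set m := ⌊s / h⌋₊ with hm
  have m1 : m * h ≤ s := by rw [← le_div_iff₀ hh]; exact Nat.floor_le (by positivity)
  have m2 : s ≤ (m + 1) * h := by rw [← div_le_iff₀ hh]; exact (Nat.lt_floor_add_one _).le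
  have hnn : 0 ≤ K * L * h ^ (α + γ) := by positivity
  rw [gridSum_eq_of_mem hh m1 m2]
  rcases le_total t ((m + 1) * h) with h3 | h3
  · rw [gridSum_eq_of_mem hh (m1.trans hst) h3]
    have e : ∀ a : ℝ, a + f (m * h) * (g t - g (m * h)) - (a + f (m * h) * (g s - g (m * h))) -
        f s * (g t - g s) = (f (m * h) - f s) * (g t - g s) := by intro a; ring
    rw [e]
    have := prod (m * h) s t s (by rw [abs_le]; constructor <;> linarith)
      (by rw [abs_le]; constructor <;> linarith)
    linarith
  · rw [gridSum_eq_of_mem hh (m := m + 1) (by push_cast; exact h3) (by push_cast; linarith),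
      Finset.sum_range_succ]
    have e : ∀ a : ℝ, a + f (m * h) * (g ((m + 1) * h) - g (m * h)) +
        f ((m + 1 : ℕ) * h) * (g t - g ((m + 1 : ℕ) * h)) -
        (a + f (m * h) * (g s - g (m * h))) - f s * (g t - g s) =
        (f (m * h) - f s) * (g ((m + 1) * h) - g s) +
        (f ((m + 1) * h) - f s) * (g t - g ((m + 1) * h)) := by intro a; push_cast; ring
    rw [e]
    refine (abs_add_le _ _).trans ?_
    have p1 := prod (m * h) s ((m + 1) * h) s (by rw [abs_le]; constructor <;> linarith)
      (by rw [abs_le]; constructor <;> linarith)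
    have p2 := prod ((m + 1) * h) s t ((m + 1) * h) (by rw [abs_le]; constructor <;> linarith)
      (by rw [abs_le]; constructor <;> linarith)
    linarith

/-- A length `d ∈ (0, 1]` lies between two consecutive powers of `1 / 2`. -/
lemma exists_half_pow_between {d : ℝ} (h0 : 0 < d) (h1 : d ≤ 1) :
    ∃ n : ℕ, d ≤ (1 / 2 : ℝ) ^ n ∧ (1 / 2 : ℝ) ^ n ≤ 2 * d := by
  obtain ⟨n, h2, h3⟩ := exists_nat_pow_near_of_lt_one h0 h1 (y := (1 / 2 : ℝ)) (by norm_num)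
    (by norm_num)
  refine ⟨n, h3, ?_⟩
  rw [pow_succ] at h2
  linarith

/-- **Sewing**: if `f` and `g` are Hölder of orders `α` and `γ` with `α + γ > 1`, the grid sums
along the dyadic grids converge to a function `F` whose increments are those of `f dg` up to an
error of order `α + γ`. -/
theorem exists_sewing {f g : ℝ → ℝ} {α γ K L : ℝ} (hα : 0 ≤ α) (hγ : 0 ≤ γ) (hαγ : 1 < α + γ)
    (hK : 0 ≤ K) (hL : 0 ≤ L)
    (hf : ∀ s t, |f t - f s| ≤ K * |t - s| ^ α) (hg : ∀ s t, |g t - g s| ≤ L * |t - s| ^ γ) :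
    ∃ (F : ℝ → ℝ) (C : ℝ), 0 ≤ C ∧ F 0 = 0 ∧ ∀ s t, 0 ≤ s → s ≤ t → t - s ≤ 1 →
      |F t - F s - f s * (g t - g s)| ≤ C * (t - s) ^ (α + γ) := by
  set θ := α + γ with hθ
  set h : ℕ → ℝ := fun n => (1 / 2 : ℝ) ^ n with hhdef
  -- `G n` is the change from level `n` to level `n + 1`; its increments decay like `ρ ^ n`
  have hh : ∀ n, 0 < h n := fun n => by positivity
  have hsucc : ∀ n, h (n + 1) = h n / 2 := fun n => by simp only [hhdef, pow_succ]; ring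
  set G : ℕ → ℝ → ℝ := fun n t => gridSum f g (h (n + 1)) t - gridSum f g (h n) t with hG
  have G0 : ∀ n, G n 0 = 0 := fun n => by simp [hG, gridSum_zero]
  set ρ : ℝ := (1 / 2 : ℝ) ^ (θ - 1) with hρ
  have ρ0 : 0 < ρ := by positivity
  have ρ1 : ρ < 1 := Real.rpow_lt_one (by norm_num) (by norm_num) (by linarith)
  have hhρ : ∀ n, h n ^ θ = ρ ^ n * h n := by
    intro n
    rw [show θ = (θ - 1) + 1 by ring, Real.rpow_add (hh n), Real.rpow_one]
    congr 1
    simp only [hhdef, hρ]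
    rw [← Real.rpow_natCast, ← Real.rpow_natCast, ← Real.rpow_mul (by norm_num),
      ← Real.rpow_mul (by norm_num), mul_comm]
  have Gb : ∀ n s t, 0 ≤ s → s ≤ t → |G n t - G n s| ≤ K * L * ρ ^ n * ((t - s) + 3 * h n) := by
    intro n s t hs hst
    have := abs_sub_le_of_cells (G := G n) (hh n) (c := K * L * h n ^ θ) (fun m t h1 h2 => by
      have := abs_gridSum_halve_sub_le hα hγ hK hL hf hg (hh n) h1 h2
      simp only [hG, hsucc]; exact this) hs hst
    refine this.trans (le_of_eq ?_)
    rw [hhρ]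
    have := (hh n).ne'
    field_simp
  have sumρ : Summable fun n => ρ ^ n := summable_geometric_of_lt_one ρ0.le ρ1
  have hh1 : ∀ n, h n ≤ 1 := fun n => pow_le_one₀ (by norm_num) (by norm_num)
  have Gsum : ∀ t, 0 ≤ t → Summable fun n => G n t := by
    intro t ht
    refine Summable.of_norm_bounded ((sumρ.mul_left (K * L)).mul_right (t + 3)) fun n => ?_
    have := Gb n 0 t le_rfl ht
    rw [G0, sub_zero, sub_zero] at this
    rw [Real.norm_eq_abs]
    refine this.trans ?_
    have := hh1 n
    gcongr
    linarith
  set F : ℝ → ℝ := fun t => gridSum f g (h 0) t + ∑' n, G n t with hF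
  set C0 : ℝ := 2 * (K * L) + 4 * (K * L) * (1 - ρ)⁻¹ with hC0
  have hC0' : 0 ≤ C0 := by
    have : 0 ≤ (1 - ρ)⁻¹ := inv_nonneg.2 (by linarith)
    positivity
  have Ftail : ∀ n t, 0 ≤ t → F t = gridSum f g (h n) t + ∑' k, G (k + n) t := by
    intro n t ht
    have h1 := (Gsum t ht).sum_add_tsum_nat_add n
    have h2 : ∑ i ∈ Finset.range n, G i t = gridSum f g (h n) t - gridSum f g (h 0) t := by
      simp only [hG]
      exact Finset.sum_range_sub (fun i => gridSum f g (h i) t) n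
    simp only [hF]
    rw [← h1, h2]; ring
  refine ⟨F, C0 * 2 ^ θ, by positivity, by simp [hF, gridSum_zero, G0], fun s t hs hst h1 => ?_⟩
  rcases hst.eq_or_lt with rfl | hlt
  · simp only [sub_self, mul_zero, abs_zero]
    positivity
  -- compare with the grid whose mesh is the length of the interval, up to a factor `2`
  obtain ⟨n, n1, n2⟩ := exists_half_pow_between (sub_pos.2 hlt) h1
  change t - s ≤ h n at n1
  change h n ≤ _ at n2
  have key : |F t - F s - f s * (g t - g s)| ≤ C0 * h n ^ θ := by
    rw [Ftail n t (hs.trans hst), Ftail n s hs]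
    have st := (summable_nat_add_iff n).2 (Gsum t (hs.trans hst))
    have ss := (summable_nat_add_iff n).2 (Gsum s hs)
    have tail : |∑' k, G (k + n) t - ∑' k, G (k + n) s| ≤ 4 * (K * L) * (1 - ρ)⁻¹ * h n ^ θ := by
      rw [← st.tsum_sub ss, ← Real.norm_eq_abs]
      refine tsum_of_norm_bounded (g := fun k => ρ ^ k * (4 * (K * L) * h n ^ θ)) ?_ fun k => ?_
      · have := (hasSum_geometric_of_lt_one ρ0.le ρ1).mul_right (4 * (K * L) * h n ^ θ)
        rwa [show (1 - ρ)⁻¹ * (4 * (K * L) * h n ^ θ) = 4 * (K * L) * (1 - ρ)⁻¹ * h n ^ θ by ring]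
          at this
      · rw [Real.norm_eq_abs]
        refine (Gb (k + n) s t hs hst).trans ?_
        have : h (k + n) ≤ h n := by
          simp only [hhdef]
          exact pow_le_pow_of_le_one (by norm_num) (by norm_num) (by omega)
        calc _ ≤ K * L * ρ ^ (k + n) * (h n + 3 * h n) := by gcongr
          _ = _ := by rw [hhρ, pow_add]; ring
    have main := abs_gridSum_sub_sub_le hα hγ hK hL hf hg (hh n) hs hst n1
    have e : gridSum f g (h n) t + ∑' k, G (k + n) t - (gridSum f g (h n) s + ∑' k, G (k + n) s) -
        f s * (g t - g s) = (gridSum f g (h n) t - gridSum f g (h n) s - f s * (g t - g s)) +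
        (∑' k, G (k + n) t - ∑' k, G (k + n) s) := by ring
    rw [e]
    refine (abs_add_le _ _).trans ((add_le_add main tail).trans (le_of_eq ?_))
    rw [hC0]; ring
  refine key.trans ?_
  rw [mul_assoc, ← Real.mul_rpow (by norm_num) (by linarith)]
  have := (hh n).le
  gcongr

/-- `f` is Hölder continuous of order `γ` on `[0, T]`, with the constant `C`. This is
`HolderOnWith` on an interval, with real parameters and absolute values. -/
def HolderOnInterval (C γ T : ℝ) (f : ℝ → ℝ) : Prop :=
  0 ≤ C ∧ ∀ s ∈ Icc 0 T, ∀ t ∈ Icc 0 T, |f t - f s| ≤ C * |t - s| ^ γ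

lemma HolderOnInterval.continuousOn {C γ T : ℝ} {f : ℝ → ℝ} (h : HolderOnInterval C γ T f)
    (hγ : 0 < γ) : ContinuousOn f (Icc 0 T) := by
  have : HolderOnWith C.toNNReal γ.toNNReal f (Icc 0 T) := by
    intro s hs t ht
    rw [edist_dist, edist_dist, Real.dist_eq, Real.dist_eq, Real.coe_toNNReal _ hγ.le,
      ENNReal.ofReal_rpow_of_nonneg (abs_nonneg _) hγ.le, ENNReal.ofNNReal_toNNReal,
      ← ENNReal.ofReal_mul h.1]
    exact ENNReal.ofReal_le_ofReal (h.2 t ht s hs)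
  exact this.continuousOn (by simpa using hγ)

/-- A Hölder continuous function on `[0, T]` in Mathlib's sense is so with any smaller order. -/
lemma HolderOnWith.holderOnInterval {K α : ℝ≥0} {T : ℝ} {f : ℝ → ℝ}
    (h : HolderOnWith K α f (Icc 0 T)) {β : ℝ} (hβ : 0 ≤ β) (hβα : β ≤ α) :
    ∃ C, HolderOnInterval C β T f := by
  lift β to ℝ≥0 using hβ
  refine ⟨K * (max T 1) ^ ((α : ℝ) - β), by positivity, fun s hs t ht => ?_⟩
  have h1 := h.dist_le ht hs
  rw [Real.dist_eq, Real.dist_eq] at h1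
  refine h1.trans ?_
  rcases eq_or_ne t s with rfl | hne
  · rw [sub_self, abs_zero]
    rcases eq_or_ne (α : ℝ) 0 with h0 | h0
    · have : (β : ℝ) = 0 := le_antisymm (by rw [← h0]; exact_mod_cast hβα) β.2
      simp [h0, this]
    · rw [Real.zero_rpow h0]; simp only [mul_zero]; positivity
  have hpos : 0 < |t - s| := abs_pos.2 (sub_ne_zero.2 hne)
  rw [mul_assoc]
  gcongr
  rw [show (α : ℝ) = (α - β) + β by ring, Real.rpow_add hpos, add_sub_cancel_right]
  gcongr
  refine le_max_of_le_left ?_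
  rw [abs_le]; constructor <;> linarith [hs.1, hs.2, ht.1, ht.2]

/-- Hölder continuity at distances at most `1` is enough on a bounded interval. -/
lemma exists_holderOnInterval_of_local {f : ℝ → ℝ} {C γ T : ℝ} (hC : 0 ≤ C)
    (hγ : 0 ≤ γ) (h : ∀ s t, s ∈ Icc 0 T → t ∈ Icc 0 T → s ≤ t → t - s ≤ 1 →
      |f t - f s| ≤ C * (t - s) ^ γ) : ∃ C', HolderOnInterval C' γ T f := by
  have step : ∀ (n : ℕ) (s t : ℝ), s ∈ Icc 0 T → t ∈ Icc 0 T → s ≤ t → t - s ≤ n →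
      |f t - f s| ≤ n * C := by
    intro n
    induction n with
    | zero =>
      intro s t _ _ hst h0
      have : t = s := le_antisymm (by push_cast at h0; linarith) hst
      simp [this]
    | succ n ih =>
      intro s t hs ht hst h1
      push_cast at h1
      have hm : max s (t - 1) ∈ Icc 0 T :=
        ⟨hs.1.trans (le_max_left _ _), max_le hs.2 (by linarith [ht.2])⟩
      have hmt : max s (t - 1) ≤ t := max_le hst (by linarith)
      have a1 := h _ _ hm ht hmt (by linarith [le_max_right s (t - 1)])
      have a2 := ih _ _ hs hm (le_max_left _ _)
        (by
          rcases max_choice s (t - 1) with h | h <;> rw [h]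
          · simp
          · linarith)
      have a3 : (t - max s (t - 1)) ^ γ ≤ 1 :=
        Real.rpow_le_one (by linarith) (by linarith [le_max_right s (t - 1)]) hγ
      calc _ ≤ |f t - f (max s (t - 1))| + |f (max s (t - 1)) - f s| := abs_sub_le _ _ _
        _ ≤ C * 1 + n * C := add_le_add (a1.trans (by gcongr)) a2
        _ = _ := by push_cast; ring
  have main : ∀ s t, s ∈ Icc 0 T → t ∈ Icc 0 T → s ≤ t →
      |f t - f s| ≤ (⌈T⌉₊ * C + C) * (t - s) ^ γ := by
    intro s t hs ht hst
    have hT : (0 : ℝ) ≤ ⌈T⌉₊ * C := by positivity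
    have h0 : 0 ≤ (t - s) ^ γ := Real.rpow_nonneg (by linarith) _
    rcases le_total (t - s) 1 with h1 | h1
    · refine (h s t hs ht hst h1).trans ?_
      gcongr; linarith
    · have a := step ⌈T⌉₊ s t hs ht hst (by linarith [hs.1, ht.2, Nat.le_ceil T])
      have b : 1 ≤ (t - s) ^ γ := Real.one_le_rpow h1 hγ
      nlinarith
  refine ⟨⌈T⌉₊ * C + C, by positivity, fun s hs t ht => ?_⟩
  rcases le_total s t with hst | hst
  · rw [abs_of_nonneg (sub_nonneg.2 hst)]; exact main s t hs ht hst
  · rw [abs_sub_comm, abs_sub_comm t, abs_of_nonneg (sub_nonneg.2 hst)]; exact main t s ht hs hst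

/-- The increments of `F` on `[0, T]` are those of `f dg` up to an error of order `θ`. -/
def IsSewing (C θ T : ℝ) (f g F : ℝ → ℝ) : Prop :=
  0 ≤ C ∧ F 0 = 0 ∧ ∀ s ∈ Icc 0 T, ∀ t ∈ Icc 0 T, |t - s| ≤ 1 →
    |F t - F s - f s * (g t - g s)| ≤ C * |t - s| ^ θ

lemma exists_isSewing {f g : ℝ → ℝ} {α γ K L T : ℝ} (hT : 0 ≤ T) (hα : 0 ≤ α) (hγ : 0 ≤ γ)
    (hαγ : 1 < α + γ) (hf : HolderOnInterval K α T f) (hg : HolderOnInterval L γ T g) :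
    ∃ F C, IsSewing C (α + γ) T f g F := by
  have ext : ∀ {k : ℝ → ℝ} {M β : ℝ}, 0 ≤ β → HolderOnInterval M β T k → ∀ s t,
      |k (projIcc 0 T hT t) - k (projIcc 0 T hT s)| ≤ M * |t - s| ^ β := by
    intro k M β hβ hk s t
    refine (hk.2 _ (projIcc 0 T hT s).2 _ (projIcc 0 T hT t).2).trans ?_
    exact mul_le_mul_of_nonneg_left
      (Real.rpow_le_rpow (abs_nonneg _) (abs_projIcc_sub_projIcc hT) hβ) hk.1
  obtain ⟨F, C, hC, hF0, hF⟩ := exists_sewing hα hγ hαγ hf.1 hg.1 (ext hα hf) (ext hγ hg)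
  have key : ∀ s ∈ Icc 0 T, ∀ t ∈ Icc 0 T, s ≤ t → t - s ≤ 1 →
      |F t - F s - f s * (g t - g s)| ≤ C * (t - s) ^ (α + γ) := by
    intro s hs t ht hst h1
    have := hF s t hs.1 hst h1
    rwa [projIcc_of_mem hT hs, projIcc_of_mem hT ht] at this
  refine ⟨F, C + K * L, add_nonneg hC (mul_nonneg hf.1 hg.1), hF0, fun s hs t ht h1 => ?_⟩
  have hKL : 0 ≤ K * L := mul_nonneg hf.1 hg.1
  rcases le_total s t with hst | hst
  · rw [abs_of_nonneg (sub_nonneg.2 hst)] at h1 ⊢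
    refine (key s hs t ht hst h1).trans ?_
    have : 0 ≤ (t - s) ^ (α + γ) := Real.rpow_nonneg (by linarith) _
    gcongr; linarith
  · have e : F t - F s - f s * (g t - g s) =
      -(F s - F t - f t * (g s - g t)) + (f t - f s) * (g t - g s) := by ring
    rw [e]
    refine (abs_add_le _ _).trans ?_
    rw [abs_neg, add_mul]
    have hst' : |t - s| = s - t := by rw [abs_sub_comm, abs_of_nonneg (sub_nonneg.2 hst)]
    refine add_le_add ?_ ?_
    · rw [hst'] at h1 ⊢
      exact key t ht s hs hst h1
    · rw [abs_mul, Real.rpow_add_of_nonneg (abs_nonneg _) hα hγ]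
      calc _ ≤ (K * |t - s| ^ α) * (L * |t - s| ^ γ) :=
            mul_le_mul (hf.2 s hs t ht) (hg.2 s hs t ht) (abs_nonneg _)
              (mul_nonneg hf.1 (by positivity))
        _ = _ := by ring

lemma mem_Icc_of_partition {t : ℕ → ℝ} {n : ℕ} {a b : ℝ} (h0 : t 0 = a) (hn : t n = b)
    (h : ∀ i < n, t i ≤ t (i + 1)) : ∀ i ≤ n, t i ∈ Icc a b := by
  have mono : ∀ j ≤ n, ∀ i ≤ j, t i ≤ t j := by
    intro j
    induction j with
    | zero => intro _ i hi; rw [Nat.le_zero.1 hi]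
    | succ j ih =>
      intro hj i hi
      rcases Nat.le_succ_iff.1 hi with h1 | h1
      · exact (ih (by omega) i h1).trans (h j (by omega))
      · rw [h1]
  intro i hi
  exact ⟨h0 ▸ mono i hi 0 (Nat.zero_le _), hn ▸ mono n le_rfl i hi⟩

/-- A sewing of order greater than `1` is the Riemann-Stieltjes integral: over a partition of mesh
`δ` the errors add up to at most a constant times `δ ^ (θ - 1)`. -/
theorem IsSewing.isRiemannStieltjesIntegral {f g F : ℝ → ℝ} {α γ K L C T : ℝ}
    (hα : 0 ≤ α) (hγ : 0 ≤ γ) (hαγ : 1 < α + γ)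
    (hf : HolderOnInterval K α T f) (hg : HolderOnInterval L γ T g)
    (hF : IsSewing C (α + γ) T f g F) {x : ℝ} (hx : x ∈ Icc 0 T) :
    IsRiemannStieltjesIntegral f g 0 x (F x) := by
  intro ε hε
  set θ := α + γ
  have hD : 0 ≤ C + K * L := add_nonneg hF.1 (mul_nonneg hf.1 hg.1)
  have hlim : Tendsto (fun δ : ℝ => (C + K * L) * x * δ ^ (θ - 1)) (nhdsWithin 0 (Ioi 0))
      (nhds 0) := by
    have : ContinuousAt (fun δ : ℝ => (C + K * L) * x * δ ^ (θ - 1)) 0 :=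
      continuousAt_const.mul (Real.continuousAt_rpow_const _ _ (Or.inr (by linarith)))
    have h2 := this.tendsto
    rw [Real.zero_rpow (by linarith), mul_zero] at h2
    exact h2.mono_left nhdsWithin_le_nhds
  obtain ⟨δ, hδε, hδ0, hδ1⟩ := ((hlim.eventually (gt_mem_nhds hε)).and
    (Ioo_mem_nhdsGT (zero_lt_one' ℝ))).exists
  refine ⟨δ, hδ0, fun n t ξ h0 hn hp => ?_⟩
  have mem := mem_Icc_of_partition h0 hn fun i hi => (hp i hi).1.trans (hp i hi).2.1
  have memT : ∀ i ≤ n, t i ∈ Icc 0 T := fun i hi => ⟨(mem i hi).1, (mem i hi).2.trans hx.2⟩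
  have term : ∀ i ∈ Finset.range n,
      |f (ξ i) * (g (t (i + 1)) - g (t i)) - (F (t (i + 1)) - F (t i))| ≤
        (C + K * L) * δ ^ (θ - 1) * (t (i + 1) - t i) := by
    intro i hi
    rw [Finset.mem_range] at hi
    obtain ⟨p1, p2, p3⟩ := hp i hi
    have m1 := memT i hi.le
    have m2 := memT (i + 1) hi
    have m3 : ξ i ∈ Icc 0 T := ⟨m1.1.trans p1, p2.trans m2.2⟩
    have hd : 0 ≤ t (i + 1) - t i := by linarith
    have e : f (ξ i) * (g (t (i + 1)) - g (t i)) - (F (t (i + 1)) - F (t i)) =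
        (f (ξ i) - f (t i)) * (g (t (i + 1)) - g (t i)) -
          (F (t (i + 1)) - F (t i) - f (t i) * (g (t (i + 1)) - g (t i))) := by ring
    have b1 : |(f (ξ i) - f (t i)) * (g (t (i + 1)) - g (t i))| ≤
        K * L * (t (i + 1) - t i) ^ θ := by
      rw [abs_mul, Real.rpow_add_of_nonneg hd hα hγ]
      have q1 := hf.2 _ m1 _ m3
      have q2 := hg.2 _ m1 _ m2
      rw [abs_of_nonneg hd] at q2
      rw [abs_of_nonneg (sub_nonneg.2 p1)] at q1
      have q3 : K * (ξ i - t i) ^ α ≤ K * (t (i + 1) - t i) ^ α := by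
        have := hf.1
        have := sub_nonneg.2 p1
        gcongr
      have := hg.1
      have := hf.1
      calc _ ≤ (K * (t (i + 1) - t i) ^ α) * (L * (t (i + 1) - t i) ^ γ) :=
            mul_le_mul (q1.trans q3) q2 (abs_nonneg _) (by positivity)
        _ = _ := by ring
    have b2 := hF.2.2 _ m1 _ m2 (by rw [abs_of_nonneg hd]; linarith)
    rw [abs_of_nonneg hd] at b2
    have b3 : (t (i + 1) - t i) ^ θ ≤ δ ^ (θ - 1) * (t (i + 1) - t i) := by
      rcases hd.eq_or_lt with h | h
      · rw [← h, Real.zero_rpow (by linarith), mul_zero]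
      · rw [show θ = (θ - 1) + 1 by ring, Real.rpow_add h, Real.rpow_one, add_sub_cancel_right]
        gcongr
    rw [e]
    calc _ ≤ K * L * (t (i + 1) - t i) ^ θ + C * (t (i + 1) - t i) ^ θ :=
          (abs_sub _ _).trans (add_le_add b1 b2)
      _ = (C + K * L) * (t (i + 1) - t i) ^ θ := by ring
      _ ≤ (C + K * L) * (δ ^ (θ - 1) * (t (i + 1) - t i)) := by gcongr
      _ = _ := by ring
  have tel : ∑ i ∈ Finset.range n, (F (t (i + 1)) - F (t i)) = F x := by
    rw [Finset.sum_range_sub (fun i => F (t i)), h0, hn, hF.2.1, sub_zero]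
  have tel' : ∑ i ∈ Finset.range n, (t (i + 1) - t i) = x := by
    rw [Finset.sum_range_sub, h0, hn, sub_zero]
  rw [← tel, ← Finset.sum_sub_distrib]
  calc _ ≤ ∑ i ∈ Finset.range n, (C + K * L) * δ ^ (θ - 1) * (t (i + 1) - t i) :=
        (Finset.abs_sum_le_sum_abs _ _).trans (Finset.sum_le_sum term)
    _ = (C + K * L) * x * δ ^ (θ - 1) := by rw [← Finset.mul_sum, tel']; ring
    _ < ε := hδε

/-- The Riemann sums over equal cells converge to the integral. -/
lemma IsRiemannStieltjesIntegral.tendsto_equal_cells {f g : ℝ → ℝ} {x I : ℝ} (hx : 0 ≤ x)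
    (h : IsRiemannStieltjesIntegral f g 0 x I) :
    Tendsto (fun n : ℕ => ∑ i ∈ Finset.range (n + 1), f (i * (x / (n + 1))) *
      (g ((i + 1 : ℕ) * (x / (n + 1))) - g (i * (x / (n + 1))))) atTop (nhds I) := by
  rw [Metric.tendsto_atTop]
  intro ε hε
  obtain ⟨δ, hδ, H⟩ := h ε hε
  obtain ⟨M, hM⟩ := exists_nat_gt (x / δ)
  refine ⟨M, fun n hn => ?_⟩
  have hn1 : (0 : ℝ) < n + 1 := by positivity
  have hc : 0 ≤ x / (n + 1) := by positivity
  have hs : x / (n + 1) < δ := by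
    rw [div_lt_iff₀ hn1, mul_comm, ← div_lt_iff₀ hδ]
    have : (M : ℝ) ≤ n := by exact_mod_cast hn
    linarith
  rw [Real.dist_eq]
  refine H (n + 1) (fun i => i * (x / (n + 1))) (fun i => i * (x / (n + 1))) (by simp)
    (by push_cast; field_simp) fun i _ => ⟨le_rfl, by push_cast; nlinarith, by push_cast; linarith⟩

lemma riemannStieltjesIntegral_eq {f g : ℝ → ℝ} {x I : ℝ} (hx : 0 ≤ x)
    (h : IsRiemannStieltjesIntegral f g 0 x I) : riemannStieltjesIntegral f g 0 x = I := by
  have hex : ∃ I, IsRiemannStieltjesIntegral f g 0 x I := ⟨I, h⟩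
  rw [riemannStieltjesIntegral, dif_pos hex]
  exact tendsto_nhds_unique (hex.choose_spec.tendsto_equal_cells hx) (h.tendsto_equal_cells hx)

/-- A sewing inherits the Hölder order of the integrator. -/
lemma IsSewing.exists_holderOnInterval {f g F : ℝ → ℝ} {θ γ L C T : ℝ} (hγ : 0 ≤ γ) (hγθ : γ ≤ θ)
    (hf : ContinuousOn f (Icc 0 T)) (hg : HolderOnInterval L γ T g) (hF : IsSewing C θ T f g F) :
    ∃ C', HolderOnInterval C' γ T F := by
  obtain ⟨M, hM⟩ := isCompact_Icc.exists_bound_of_continuousOn hf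
  have hL := hg.1
  have hC := hF.1
  refine exists_holderOnInterval_of_local (C := |M| * L + C) (by positivity) hγ
    fun s t hs ht hst h1 => ?_
  have hd : 0 ≤ t - s := sub_nonneg.2 hst
  have a1 := hF.2.2 s hs t ht (by rwa [abs_of_nonneg hd])
  have a2 := hg.2 s hs t ht
  have a3 := (hM s hs).trans (le_abs_self M)
  rw [Real.norm_eq_abs] at a3
  rw [abs_of_nonneg hd] at a1 a2
  have a4 : (t - s) ^ θ ≤ (t - s) ^ γ := by
    rcases hd.eq_or_lt with h | h
    · rw [← h]
      rcases eq_or_ne γ 0 with h0 | h0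
      · rw [h0, Real.rpow_zero]; exact Real.rpow_le_one le_rfl zero_le_one (h0 ▸ hγθ)
      · rw [Real.zero_rpow h0, Real.zero_rpow ((hγ.lt_of_ne' h0).trans_le hγθ).ne']
    · exact Real.rpow_le_rpow_of_exponent_ge h h1 hγθ
  calc |F t - F s| = |f s * (g t - g s) + (F t - F s - f s * (g t - g s))| := by ring_nf
    _ ≤ |f s| * |g t - g s| + |F t - F s - f s * (g t - g s)| := by
        rw [← abs_mul]; exact abs_add_le _ _
    _ ≤ |M| * (L * (t - s) ^ γ) + C * (t - s) ^ γ := by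
        refine add_le_add (mul_le_mul a3 a2 (abs_nonneg _) (abs_nonneg _)) (a1.trans ?_)
        gcongr
    _ = _ := by ring

/-! ### Hölder continuity of the paths of fractional Brownian motion -/

lemma half_pow_rpow (n : ℕ) (γ : ℝ) : ((1 / 2 : ℝ) ^ n) ^ γ = ((1 / 2 : ℝ) ^ γ) ^ n := by
  rw [← Real.rpow_natCast, ← Real.rpow_natCast, ← Real.rpow_mul (by norm_num),
    ← Real.rpow_mul (by norm_num), mul_comm]

/-- **Chaining**: a continuous function whose increments over dyadic intervals are of order `γ` is
Hölder continuous of order `γ`. -/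
theorem exists_holderOnInterval_of_dyadic {b : ℝ → ℝ} (hb : Continuous b) {K γ : ℝ} {M : ℕ}
    (hK : 0 ≤ K) (hγ : 0 < γ)
    (h : ∀ n i : ℕ, i < M * 2 ^ n →
      |b ((i + 1) * (1 / 2 : ℝ) ^ n) - b (i * (1 / 2 : ℝ) ^ n)| ≤ K * ((1 / 2 : ℝ) ^ n) ^ γ) :
    ∃ C, HolderOnInterval C γ M b := by
  set r : ℕ → ℝ := fun n => (1 / 2 : ℝ) ^ n with hr
  have r0 : ∀ n, 0 < r n := fun n => by positivity
  have rsucc : ∀ n, r n = 2 * r (n + 1) := fun n => by simp only [hr, pow_succ]; ring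
  have rinv : ∀ n, r n * 2 ^ n = 1 := fun n => by simp only [hr]; rw [← mul_pow]; norm_num
  set ρ : ℝ := (1 / 2 : ℝ) ^ γ with hρ
  have ρ0 : 0 < ρ := by positivity
  have ρ1 : ρ < 1 := Real.rpow_lt_one (by norm_num) (by norm_num) hγ
  have rρ : ∀ n, r n ^ γ = ρ ^ n := fun n => half_pow_rpow n γ
  have index : ∀ (n i : ℕ) (t : ℝ), t ≤ M → (i + 1) * r n ≤ t → i < M * 2 ^ n := by
    intro n i t ht hi
    have h1 : ((i : ℝ) + 1) * (r n * 2 ^ n) ≤ M * 2 ^ n := by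
      rw [← mul_assoc]; exact mul_le_mul_of_nonneg_right (hi.trans ht) (by positivity)
    rw [rinv, mul_one] at h1
    have : i + 1 ≤ M * 2 ^ n := by exact_mod_cast h1
    omega
  set q : ℕ → ℝ → ℝ := fun n t => ⌊t / r n⌋₊ * r n with hq
  have q1 : ∀ n t, 0 ≤ t → q n t ≤ t := fun n t ht => by
    have := r0 n
    simp only [hq]; rw [← le_div_iff₀ this]; exact Nat.floor_le (by positivity)
  have q2 : ∀ n t, t < q n t + r n := fun n t => by
    have h1 := Nat.lt_floor_add_one (t / r n)
    rw [div_lt_iff₀ (r0 n)] at h1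
    simp only [hq]; linarith
  have conv : ∀ t : ℝ, 0 ≤ t → t ≤ M → ∀ n, |b t - b (q n t)| ≤ K * ρ ^ n / (1 - ρ) := by
    intro t ht htM n
    have hlim : Tendsto (fun n => b (q n t)) atTop (nhds (b t)) := by
      refine (hb.tendsto t).comp ?_
      refine tendsto_of_tendsto_of_tendsto_of_le_of_le (g := fun n => t - r n) (h := fun _ => t)
        ?_ tendsto_const_nhds (fun n => by simp only; linarith [q2 n t]) (fun n => q1 n t ht)
      have h0 : Tendsto r atTop (nhds 0) :=
        tendsto_pow_atTop_nhds_zero_of_lt_one (by norm_num) (by norm_num)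
      simpa using tendsto_const_nhds.sub h0
    have := dist_le_of_le_geometric_of_tendsto ρ K ρ1 (f := fun n => b (q n t)) (fun n => ?_) hlim n
    · rw [dist_comm] at this
      exact this
    · -- passing from level `n` to level `n + 1` moves the grid point by at most one fine cell
      set m := ⌊t / r n⌋₊ with hm
      set m' := ⌊t / r (n + 1)⌋₊ with hm'
      have a1 := q1 n t ht
      have a2 := q2 n t
      have a3 := q1 (n + 1) t ht
      have a4 := q2 (n + 1) t
      simp only [hq] at a1 a2 a3 a4 ⊢
      rw [← hm] at a1 a2 ⊢
      rw [← hm'] at a3 a4 ⊢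
      rw [rsucc n] at a1 a2 ⊢
      have c1 : 2 * m ≤ m' := by
        by_contra hc
        have : (m' : ℝ) + 1 ≤ 2 * m := by exact_mod_cast (by omega : m' + 1 ≤ 2 * m)
        nlinarith [r0 (n + 1)]
      have c2 : m' < 2 * m + 2 := by
        by_contra hc
        have : (2 * m + 2 : ℝ) ≤ m' := by exact_mod_cast (by omega : 2 * m + 2 ≤ m')
        nlinarith [r0 (n + 1)]
      rw [dist_comm, Real.dist_eq]
      rcases (by omega : m' = 2 * m ∨ m' = 2 * m + 1) with e | e
      · rw [e, show ((2 * m : ℕ) : ℝ) * r (n + 1) = m * (2 * r (n + 1)) by push_cast; ring,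
          sub_self, abs_zero]
        positivity
      · have b1 := h (n + 1) (2 * m) (index (n + 1) (2 * m) t htM (by
          rw [e] at a3; push_cast at a3 ⊢; exact a3))
        rw [e, show (m : ℝ) * (2 * r (n + 1)) = ((2 * m : ℕ) : ℝ) * r (n + 1) by push_cast; ring,
          show ((2 * m + 1 : ℕ) : ℝ) = ((2 * m : ℕ) : ℝ) + 1 by push_cast; ring]
        refine b1.trans ?_
        change K * r (n + 1) ^ γ ≤ _
        rw [rρ]
        exact mul_le_mul_of_nonneg_left
          (pow_le_pow_of_le_one ρ0.le ρ1.le (Nat.le_succ n)) hK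
  have h1ρ : 0 < 1 - ρ := by linarith
  set D : ℝ := 2 * (K / (1 - ρ)) + K with hD
  have hD0 : 0 ≤ D := by positivity
  refine exists_holderOnInterval_of_local (C := D * 2 ^ γ) (by positivity) hγ.le
    fun s t hs ht hst hle => ?_
  rcases hst.eq_or_lt with rfl | hlt
  · simp only [sub_self, abs_zero]; positivity
  obtain ⟨n, n1, n2⟩ := exists_half_pow_between (sub_pos.2 hlt) hle
  change t - s ≤ r n at n1
  change r n ≤ _ at n2
  have key : |b t - b s| ≤ D * r n ^ γ := by
    have a := conv t ht.1 ht.2 n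
    have c := conv s hs.1 hs.2 n
    rw [abs_sub_comm] at c
    have mid : |b (q n t) - b (q n s)| ≤ K * r n ^ γ := by
      have a1 := q1 n t ht.1
      have a2 := q2 n t
      have a3 := q1 n s hs.1
      have a4 := q2 n s
      simp only [hq] at a1 a2 a3 a4 ⊢
      set m := ⌊s / r n⌋₊
      set m' := ⌊t / r n⌋₊
      have c1 : m ≤ m' := by
        by_contra hc
        have : (m' : ℝ) + 1 ≤ m := by exact_mod_cast (by omega : m' + 1 ≤ m)
        nlinarith [r0 n]
      have c2 : m' < m + 2 := by
        by_contra hc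
        have : (m + 2 : ℝ) ≤ m' := by exact_mod_cast (by omega : m + 2 ≤ m')
        nlinarith [r0 n]
      rcases (by omega : m' = m ∨ m' = m + 1) with e | e
      · rw [e, sub_self, abs_zero]
        have := r0 n
        positivity
      · rw [e] at a1 ⊢
        push_cast at a1 ⊢
        exact h n m (index n m t ht.2 a1)
    calc |b t - b s| ≤ |b t - b (q n t)| + (|b (q n t) - b (q n s)| + |b (q n s) - b s|) :=
          (abs_sub_le _ _ _).trans (by gcongr; exact abs_sub_le _ _ _)
      _ ≤ K * ρ ^ n / (1 - ρ) + (K * r n ^ γ + K * ρ ^ n / (1 - ρ)) := by gcongr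
      _ = D * r n ^ γ := by rw [rρ, hD]; ring
  refine key.trans ?_
  rw [mul_assoc, ← Real.mul_rpow (by norm_num) (by linarith)]
  have := (r0 n).le
  gcongr

/-- A centered Gaussian variable with variance `s ^ 2` is distributed as `s` times a standard
one. -/
lemma map_eq_of_hasGaussianLaw {Ω : Type*} [MeasurableSpace Ω] {P : Measure Ω} {X : Ω → ℝ}
    (hX : HasGaussianLaw X P) (h0 : ∫ ω, X ω ∂P = 0) {s : ℝ} (h2 : ∫ ω, X ω ^ 2 ∂P = s ^ 2) :
    P.map X = (gaussianReal 0 1).map (fun x => s * x) := by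
  rw [hX.map_eq_gaussianReal, gaussianReal_map_const_mul, h0,
    variance_of_integral_eq_zero hX.aemeasurable h0, h2, mul_zero, mul_one]
  congr 1
  ext
  simp [sq_nonneg]

lemma lintegral_enorm_pow_of_hasGaussianLaw {Ω : Type*} [MeasurableSpace Ω] {P : Measure Ω}
    {X : Ω → ℝ} (hX : HasGaussianLaw X P) (h0 : ∫ ω, X ω ∂P = 0) {s : ℝ}
    (h2 : ∫ ω, X ω ^ 2 ∂P = s ^ 2) (q : ℕ) :
    ∫⁻ ω, ‖X ω‖ₑ ^ q ∂P = ‖s‖ₑ ^ q * ∫⁻ x, ‖x‖ₑ ^ q ∂(gaussianReal 0 1) := by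
  have e : ∫⁻ ω, ‖X ω‖ₑ ^ q ∂P = ∫⁻ x, ‖x‖ₑ ^ q ∂(P.map X) :=
    (lintegral_map' (f := fun x : ℝ => ‖x‖ₑ ^ q) (by fun_prop) hX.aemeasurable).symm
  rw [e, map_eq_of_hasGaussianLaw hX h0 h2,
    lintegral_map (by fun_prop) (by fun_prop), ← lintegral_const_mul _ (by fun_prop)]
  simp only [enorm_mul, mul_pow]

lemma lintegral_enorm_pow_gaussianReal_lt_top (q : ℕ) :
    ∫⁻ x, ‖x‖ₑ ^ q ∂(gaussianReal 0 1) < ⊤ := by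
  rcases eq_or_ne q 0 with rfl | hq
  · simp
  have h := (memLp_id_gaussianReal (μ := 0) (v := 1) (q : ℝ≥0)).2
  have h' := lintegral_rpow_enorm_lt_top_of_eLpNorm_lt_top (by simpa using hq) (by simp) h
  simpa using h'

namespace IsFractionalBrownianMotion

variable {Ω : Type*} [MeasurableSpace Ω] {P : Measure Ω} {H : ℝ} {B : ℝ≥0 → Ω → ℝ}

lemma integrable_mul [IsProbabilityMeasure P] (hB : IsFractionalBrownianMotion H B P)
    (s t : ℝ≥0) : Integrable (fun ω => B s ω * B t ω) P :=
  (hB.gaussian.hasGaussianLaw_eval s).memLp_two.integrable_mul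
    (hB.gaussian.hasGaussianLaw_eval t).memLp_two

lemma integral_sub_eq_zero [IsProbabilityMeasure P] (hB : IsFractionalBrownianMotion H B P)
    (s t : ℝ≥0) : ∫ ω, B t ω - B s ω ∂P = 0 := by
  rw [integral_sub (hB.gaussian.hasGaussianLaw_eval t).integrable
    (hB.gaussian.hasGaussianLaw_eval s).integrable, hB.centered, hB.centered, sub_zero]

lemma integral_sub_sq [IsProbabilityMeasure P] (hB : IsFractionalBrownianMotion H B P)
    (hH : 0 < H) (s t : ℝ≥0) :
    ∫ ω, (B t ω - B s ω) ^ 2 ∂P = (|(t : ℝ) - s| ^ H) ^ 2 := by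
  have e : ∀ ω, (B t ω - B s ω) ^ 2 = B t ω * B t ω + B s ω * B s ω - 2 * (B t ω * B s ω) := by
    intro ω; ring
  simp_rw [e]
  have hi : Integrable (fun ω => B t ω * B t ω + B s ω * B s ω) P :=
    (hB.integrable_mul t t).add (hB.integrable_mul s s)
  rw [integral_sub hi ((hB.integrable_mul t s).const_mul 2), integral_add (hB.integrable_mul t t)
    (hB.integrable_mul s s), integral_const_mul, hB.covariance, hB.covariance, hB.covariance,
    sub_self, sub_self, abs_zero, Real.zero_rpow (by positivity),
    ← Real.rpow_natCast, ← Real.rpow_mul (abs_nonneg _)]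
  push_cast
  rw [mul_comm H 2]
  ring

/-- Almost surely the dyadic increments of the path are of every order `γ < H`: a high moment of
the normalized increments, summed over all of them, is finite. -/
theorem ae_exists_dyadic_bound [IsProbabilityMeasure P] (hB : IsFractionalBrownianMotion H B P)
    (hH : 0 < H) {γ : ℝ} (hγ : γ < H) (M : ℕ) :
    ∀ᵐ ω ∂P, ∃ K, 0 ≤ K ∧ ∀ n i : ℕ, i < M * 2 ^ n →
      |B ((i + 1) * (1 / 2) ^ n) ω - B (i * (1 / 2) ^ n) ω| ≤ K * ((1 / 2 : ℝ) ^ n) ^ γ := by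
  -- the `q`-th moment of a normalized increment is of order `r n ^ ((H - γ) q) ≤ r n ^ 2`, which
  -- outweighs the number `M * 2 ^ n` of increments
  obtain ⟨q, hq⟩ := exists_nat_gt (2 / (H - γ))
  have hHγ : 0 < H - γ := by linarith
  rw [div_lt_iff₀ hHγ] at hq
  have hq0 : q ≠ 0 := by rintro rfl; norm_num at hq
  set r : ℕ → ℝ := fun n => (1 / 2 : ℝ) ^ n with hr
  have r0 : ∀ n, 0 < r n := fun n => by positivity
  set X : ℕ → ℕ → Ω → ℝ := fun n i ω =>
    (r n ^ γ)⁻¹ * (B ((i + 1) * (1 / 2) ^ n) ω - B (i * (1 / 2) ^ n) ω) with hX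
  set A := ∫⁻ x, ‖x‖ₑ ^ q ∂(gaussianReal 0 1) with hA
  have Xg : ∀ n i, HasGaussianLaw (X n i) P := fun n i => by
    have := (hB.gaussian.hasGaussianLaw_fun_sub (s := (i + 1) * (1 / 2) ^ n)
      (t := i * (1 / 2) ^ n)).fun_smul (r n ^ γ)⁻¹
    simpa only [smul_eq_mul] using this
  have moment : ∀ n i, ∫⁻ ω, ‖X n i ω‖ₑ ^ q ∂P ≤ ENNReal.ofReal (r n ^ 2) * A := by
    intro n i
    rw [lintegral_enorm_pow_of_hasGaussianLaw (Xg n i) (s := r n ^ (H - γ))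
      (by simp only [hX]; rw [integral_const_mul, hB.integral_sub_eq_zero, mul_zero])]
    · gcongr
      rw [← ofReal_norm, Real.norm_of_nonneg (by have := r0 n; positivity),
        ← ENNReal.ofReal_pow (by have := r0 n; positivity)]
      refine ENNReal.ofReal_le_ofReal ?_
      rw [← Real.rpow_natCast, ← Real.rpow_mul (r0 n).le, ← Real.rpow_natCast (r n) 2]
      refine Real.rpow_le_rpow_of_exponent_ge (r0 n) (pow_le_one₀ (by norm_num) (by norm_num)) ?_
      push_cast; rw [mul_comm]; exact hq.le
    · simp only [hX, mul_pow]
      rw [integral_const_mul, hB.integral_sub_sq hH]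
      push_cast
      rw [show ((i : ℝ) + 1) * (1 / 2) ^ n - i * (1 / 2) ^ n = r n by simp only [hr]; ring,
        abs_of_pos (r0 n), Real.rpow_sub (r0 n)]
      ring
  set S : Ω → ENNReal := fun ω => ∑' n, ∑ i ∈ Finset.range (M * 2 ^ n), ‖X n i ω‖ₑ ^ q with hS
  have meas : ∀ n, AEMeasurable (fun ω => ∑ i ∈ Finset.range (M * 2 ^ n), ‖X n i ω‖ₑ ^ q) P :=
    fun n => Finset.aemeasurable_fun_sum _ fun i _ => ((Xg n i).aemeasurable.enorm.pow_const q)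
  have SM : AEMeasurable S P := AEMeasurable.tsum meas
  have fin : ∫⁻ ω, S ω ∂P ≠ ⊤ := by
    rw [lintegral_tsum meas]
    have bound : ∀ n, ∫⁻ ω, ∑ i ∈ Finset.range (M * 2 ^ n), ‖X n i ω‖ₑ ^ q ∂P ≤
        ENNReal.ofReal (M * r n) * A := by
      intro n
      rw [lintegral_finsetSum' _ fun i _ => ((Xg n i).aemeasurable.enorm.pow_const q)]
      refine (Finset.sum_le_card_nsmul _ _ _ fun i _ => moment n i).trans (le_of_eq ?_)
      rw [Finset.card_range, nsmul_eq_mul, ← mul_assoc, ← ENNReal.ofReal_natCast,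
        ← ENNReal.ofReal_mul (by positivity)]
      congr 2
      have : (2 : ℝ) ^ n * r n = 1 := by simp only [hr]; rw [← mul_pow]; norm_num
      push_cast
      rw [pow_two, mul_assoc, ← mul_assoc (2 ^ n) (r n), this, one_mul]
    refine ne_top_of_le_ne_top ?_ (ENNReal.tsum_le_tsum bound)
    rw [ENNReal.tsum_mul_right, ← ENNReal.ofReal_tsum_of_nonneg
      (fun n => by have := r0 n; positivity) (summable_geometric_two.mul_left _)]
    exact ENNReal.mul_ne_top ENNReal.ofReal_ne_top
      (lintegral_enorm_pow_gaussianReal_lt_top q).ne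
  filter_upwards [ae_lt_top' SM fin] with ω hω
  refine ⟨1 + (S ω).toReal, by positivity, fun n i hi => ?_⟩
  have h1 : ‖X n i ω‖ₑ ^ q ≤ S ω :=
    (Finset.single_le_sum (f := fun i => ‖X n i ω‖ₑ ^ q) (fun _ _ => zero_le)
      (Finset.mem_range.2 hi)).trans
      (ENNReal.le_tsum (f := fun n => ∑ i ∈ Finset.range (M * 2 ^ n), ‖X n i ω‖ₑ ^ q) n)
  have h2 : |X n i ω| ^ q ≤ (S ω).toReal := by
    have := ENNReal.toReal_mono hω.ne h1
    rwa [ENNReal.toReal_pow, toReal_enorm, Real.norm_eq_abs] at this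
  have h3 : |X n i ω| ≤ 1 + (S ω).toReal := by
    rcases le_total |X n i ω| 1 with h | h
    · have : 0 ≤ (S ω).toReal := ENNReal.toReal_nonneg
      linarith
    · have := le_self_pow₀ h hq0
      linarith
  have hpos : 0 < r n ^ γ := Real.rpow_pos_of_pos (r0 n) _
  simp only [hX] at h3
  rw [abs_mul, abs_inv, abs_of_pos hpos, inv_mul_le_iff₀ hpos] at h3
  linarith

lemma ae_continuous (hB : IsFractionalBrownianMotion H B P) :
    ∀ᵐ ω ∂P, Continuous fun t : ℝ => B t.toNNReal ω := by
  filter_upwards [hB.continuous_paths] with ω hω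
  exact hω.comp continuous_real_toNNReal

/-- The paths of fractional Brownian motion are Hölder continuous of every order below `H`. -/
theorem ae_exists_holderOnInterval [IsProbabilityMeasure P]
    (hB : IsFractionalBrownianMotion H B P) {γ : ℝ} (hγ0 : 0 < γ) (hγ : γ < H) (T : ℝ) :
    ∀ᵐ ω ∂P, ∃ C, HolderOnInterval C γ T fun t => B t.toNNReal ω := by
  filter_upwards [hB.ae_continuous, hB.ae_exists_dyadic_bound (hγ0.trans hγ) hγ ⌈T⌉₊]
    with ω hc ⟨K, hK, hω⟩
  obtain ⟨C, hC, h⟩ := exists_holderOnInterval_of_dyadic hc hK hγ0 (M := ⌈T⌉₊) (fun n i hi => by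
    have := hω n i hi
    have e1 : (((i : ℝ) + 1) * (1 / 2 : ℝ) ^ n).toNNReal = (i + 1) * (1 / 2) ^ n := by
      ext; push_cast; rw [Real.coe_toNNReal _ (by positivity)]
    have e2 : ((i : ℝ) * (1 / 2 : ℝ) ^ n).toNNReal = i * (1 / 2) ^ n := by
      ext; push_cast; rw [Real.coe_toNNReal _ (by positivity)]
    simpa only [e1, e2] using this)
  have sub : Icc 0 T ⊆ Icc 0 (⌈T⌉₊ : ℝ) := Icc_subset_Icc_right (Nat.le_ceil T)
  exact ⟨C, hC, fun s hs t ht => h s (sub hs) t (sub ht)⟩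

end IsFractionalBrownianMotion

/-! ### Positivity of the energy -/

lemma one_sub_cos_nonneg (x : ℝ) : 0 ≤ 1 - Real.cos x := by linarith [Real.cos_le_one x]

lemma integrableOn_one_sub_cos_mul_rpow {H : ℝ} (hH : H ∈ Ioo (0 : ℝ) 1) (x : ℝ) :
    IntegrableOn (fun ξ : ℝ => (1 - Real.cos (x * ξ)) * ξ ^ (-1 - 2 * H)) (Ioi 0) := by
  have hm : ∀ s : Set ℝ, AEStronglyMeasurable
      (fun ξ : ℝ => (1 - Real.cos (x * ξ)) * ξ ^ (-1 - 2 * H)) (volume.restrict s) := by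
    intro s
    exact Measurable.aestronglyMeasurable (by fun_prop)
  rw [← Ioc_union_Ioi_eq_Ioi zero_le_one, integrableOn_union]
  constructor
  · have h1 : IntegrableOn (fun ξ : ℝ => x ^ 2 / 2 * ξ ^ (1 - 2 * H)) (Ioc 0 1) := by
      refine Integrable.const_mul ?_ _
      have := intervalIntegral.intervalIntegrable_rpow' (a := 0) (b := 1) (r := 1 - 2 * H)
        (by linarith [hH.2])
      exact (intervalIntegrable_iff_integrableOn_Ioc_of_le zero_le_one).1 this
    refine Integrable.mono' h1 (hm _) ?_
    filter_upwards [ae_restrict_mem measurableSet_Ioc] with ξ hξ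
    have h2 : 0 ≤ ξ ^ (-1 - 2 * H) := Real.rpow_nonneg hξ.1.le _
    rw [Real.norm_of_nonneg (mul_nonneg (one_sub_cos_nonneg _) h2)]
    have h3 : 1 - Real.cos (x * ξ) ≤ (x * ξ) ^ 2 / 2 := by
      linarith [Real.one_sub_sq_div_two_le_cos (x := x * ξ)]
    have h4 : ξ ^ (1 - 2 * H) = ξ ^ 2 * ξ ^ (-1 - 2 * H) := by
      rw [← Real.rpow_natCast, ← Real.rpow_add hξ.1]; congr 1; push_cast; ring
    rw [h4]
    calc _ ≤ (x * ξ) ^ 2 / 2 * ξ ^ (-1 - 2 * H) := by gcongr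
      _ = _ := by ring
  · have h1 : IntegrableOn (fun ξ : ℝ => 2 * ξ ^ (-1 - 2 * H)) (Ioi 1) :=
      (integrableOn_Ioi_rpow_of_lt (by linarith [hH.1]) zero_lt_one).const_mul _
    refine Integrable.mono' h1 (hm _) ?_
    filter_upwards [ae_restrict_mem measurableSet_Ioi] with ξ hξ
    have h2 : 0 ≤ ξ ^ (-1 - 2 * H) := Real.rpow_nonneg (zero_le_one.trans (le_of_lt hξ)) _
    rw [Real.norm_of_nonneg (mul_nonneg (one_sub_cos_nonneg _) h2)]
    gcongr
    linarith [Real.neg_one_le_cos (x * ξ)]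

lemma integral_one_sub_cos_pos {H : ℝ} (hH : H ∈ Ioo (0 : ℝ) 1) :
    0 < ∫ ξ in Ioi (0 : ℝ), (1 - Real.cos ξ) * ξ ^ (-1 - 2 * H) := by
  have hi := integrableOn_one_sub_cos_mul_rpow hH 1
  simp only [one_mul] at hi
  rw [setIntegral_pos_iff_support_of_nonneg_ae _ hi]
  · refine lt_of_lt_of_le ?_ (measure_mono (s := Ioo (0 : ℝ) 1) ?_)
    · simp
    · intro ξ hξ
      refine ⟨?_, hξ.1⟩
      rw [Function.mem_support]
      refine (mul_pos ?_ (Real.rpow_pos_of_pos hξ.1 _)).ne'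
      have := Real.cos_lt_cos_of_nonneg_of_le_pi le_rfl
        (by linarith [hξ.2, Real.pi_gt_three]) hξ.1
      rw [Real.cos_zero] at this
      linarith
  · filter_upwards [ae_restrict_mem measurableSet_Ioi] with ξ hξ
    exact mul_nonneg (one_sub_cos_nonneg _) (Real.rpow_nonneg (le_of_lt hξ) _)

/-- `|x| ^ (2 H)` is a mixture of the functions `1 - cos (x ξ)`, up to a positive constant. -/
lemma integral_one_sub_cos_mul_rpow {H : ℝ} (hH : H ∈ Ioo (0 : ℝ) 1) (x : ℝ) :
    ∫ ξ in Ioi (0 : ℝ), (1 - Real.cos (x * ξ)) * ξ ^ (-1 - 2 * H) =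
      |x| ^ (2 * H) * ∫ ξ in Ioi (0 : ℝ), (1 - Real.cos ξ) * ξ ^ (-1 - 2 * H) := by
  rcases eq_or_ne x 0 with rfl | hx
  · have : (2 * H) ≠ 0 := by have := hH.1; positivity
    simp [Real.zero_rpow this]
  have hx' : 0 < |x| := abs_pos.2 hx
  have h1 := integral_comp_mul_left_Ioi
    (fun η => (1 - Real.cos η) * (|x|⁻¹ * η) ^ (-1 - 2 * H)) 0 hx'
  rw [mul_zero] at h1
  have h2 : ∀ ξ : ℝ, (1 - Real.cos (|x| * ξ)) * (|x|⁻¹ * (|x| * ξ)) ^ (-1 - 2 * H) =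
      (1 - Real.cos (x * ξ)) * ξ ^ (-1 - 2 * H) := by
    intro ξ
    rw [← mul_assoc, inv_mul_cancel₀ hx'.ne', one_mul]
    congr 2
    rcases abs_choice x with h | h <;> rw [h]
    rw [neg_mul, Real.cos_neg]
  simp only [h2] at h1
  rw [h1, smul_eq_mul, ← integral_const_mul, ← integral_const_mul]
  refine setIntegral_congr_fun measurableSet_Ioi fun η hη => ?_
  rw [Real.mul_rpow (by positivity) (le_of_lt hη), Real.inv_rpow hx'.le, ← Real.rpow_neg hx'.le,
    show -(-1 - 2 * H) = 1 + 2 * H by ring, Real.rpow_add hx', Real.rpow_one]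
  field_simp

/-- An integrable function whose cosine and sine transforms vanish on the positive half-line is
almost everywhere zero. -/
lemma ae_eq_zero_of_cos_sin {g : ℝ → ℝ} (hg : Integrable g)
    (hc : ∀ ξ : ℝ, 0 < ξ → ∫ x, g x * Real.cos (ξ * x) = 0)
    (hs : ∀ ξ : ℝ, 0 < ξ → ∫ x, g x * Real.sin (ξ * x) = 0) (h0 : ∫ x, g x = 0) :
    g =ᵐ[volume] 0 := by
  have hc' : ∀ ξ : ℝ, ∫ x, g x * Real.cos (ξ * x) = 0 := by
    intro ξ
    rcases lt_trichotomy ξ 0 with h | rfl | h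
    · rw [← hc (-ξ) (by linarith)]
      simp only [neg_mul, Real.cos_neg]
    · simpa using h0
    · exact hc ξ h
  have hs' : ∀ ξ : ℝ, ∫ x, g x * Real.sin (ξ * x) = 0 := by
    intro ξ
    rcases lt_trichotomy ξ 0 with h | rfl | h
    · have := hs (-ξ) (by linarith)
      simp only [neg_mul, Real.sin_neg, mul_neg, integral_neg, neg_eq_zero] at this
      exact this
    · simp
    · exact hs ξ h
  have int_bdd : ∀ {k : ℝ → ℝ}, Continuous k → (∀ x, |k x| ≤ 1) →
      Integrable fun x => g x * k x := by
    intro k hk hk1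
    exact hg.mul_bdd (c := 1) hk.aestronglyMeasurable (Eventually.of_forall hk1)
  have hexp : ∀ ξ : ℝ, ∫ x, (g x : ℂ) * Complex.exp (ξ * x * Complex.I) = 0 := by
    intro ξ
    have e : ∀ x : ℝ, (g x : ℂ) * Complex.exp (ξ * x * Complex.I) =
        ((g x * Real.cos (ξ * x) : ℝ) : ℂ) + ((g x * Real.sin (ξ * x) : ℝ) : ℂ) * Complex.I := by
      intro x
      rw [← Complex.ofReal_mul, Complex.exp_mul_I]
      push_cast; ring
    simp_rw [e]
    rw [integral_add, integral_mul_const, integral_complex_ofReal, integral_complex_ofReal, hc',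
      hs']
    · simp
    · exact (int_bdd (by fun_prop) fun x => Real.abs_cos_le_one _).ofReal
    · exact (int_bdd (by fun_prop) fun x => Real.abs_sin_le_one _).ofReal.mul_const _
  have hpos : ∀ {k : ℝ → ℝ}, Integrable k → ∫⁻ x, ENNReal.ofReal (k x) ≠ ⊤ := fun hk =>
    hk.lintegral_lt_top.ne
  have hmeas : ∀ {k : ℝ → ℝ}, Integrable k →
      AEMeasurable (fun x => ENNReal.ofReal (k x)) volume := fun hk =>
    hk.aestronglyMeasurable.aemeasurable.ennreal_ofReal
  have hgn : Integrable fun x => -g x := hg.neg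
  set μ := (volume : Measure ℝ).withDensity fun x => ENNReal.ofReal (g x)
  set ν := (volume : Measure ℝ).withDensity fun x => ENNReal.ofReal (-g x)
  have : IsFiniteMeasure μ := isFiniteMeasure_withDensity (hpos hg)
  have : IsFiniteMeasure ν := isFiniteMeasure_withDensity (hpos hgn)
  have char : ∀ {k : ℝ → ℝ}, Integrable k → ∀ ξ : ℝ,
      charFun (volume.withDensity fun x => ENNReal.ofReal (k x)) ξ =
        ∫ x, ((max (k x) 0 : ℝ) : ℂ) * Complex.exp (ξ * x * Complex.I) := by
    intro k hk ξ
    rw [charFun_apply_real, integral_withDensity_eq_integral_toReal_smul₀ (hmeas hk)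
      (Eventually.of_forall fun _ => ENNReal.ofReal_lt_top)]
    refine integral_congr_ae (Eventually.of_forall fun x => ?_)
    simp only [ENNReal.toReal_ofReal', Complex.real_smul]
  have hμν : μ = ν := by
    refine Measure.ext_of_charFun (funext fun ξ => ?_)
    have int_exp : ∀ {k : ℝ → ℝ}, Integrable k →
        Integrable fun x => ((max (k x) 0 : ℝ) : ℂ) * Complex.exp (ξ * x * Complex.I) := by
      intro k hk
      refine hk.pos_part.ofReal.mul_bdd (c := 1)
        (Continuous.aestronglyMeasurable (by fun_prop)) (Eventually.of_forall fun x => ?_)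
      rw [← Complex.ofReal_mul, Complex.norm_exp_ofReal_mul_I]
    rw [char hg, char hgn, ← sub_eq_zero, ← integral_sub (int_exp hg) (int_exp hgn),
      ← hexp ξ]
    refine integral_congr_ae (Eventually.of_forall fun x => ?_)
    beta_reduce
    rw [← sub_mul, ← Complex.ofReal_sub]
    congr 2
    rcases le_total (g x) 0 with h | h
    · rw [max_eq_right h, max_eq_left (by linarith)]; ring
    · rw [max_eq_left h, max_eq_right (by linarith)]; ring
  have hae := (withDensity_eq_iff (hmeas hg) (hmeas hgn) (hpos hg)).1 hμν
  filter_upwards [hae] with x hx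
  simp only [Pi.zero_apply]
  have h1 := congrArg ENNReal.toReal hx
  simp only [ENNReal.toReal_ofReal'] at h1
  rcases le_total (g x) 0 with h | h
  · rw [max_eq_right h, max_eq_left (by linarith)] at h1; linarith
  · rw [max_eq_left h, max_eq_right (by linarith)] at h1; exact h1

/-- The energy `-1/2 ∫∫ g(u) g(v) |u - v| ^ (2 H) du dv`: for `∫ g = 0` it is the variance of
`∫ g(u) B_u du`, where `B` is fractional Brownian motion. -/
noncomputable def fbmEnergy (H : ℝ) (g : ℝ → ℝ) : ℝ :=
  -(∫ z : ℝ × ℝ, g z.1 * g z.2 * |z.1 - z.2| ^ (2 * H)) / 2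

lemma integrable_mul_mul_rpow {H : ℝ} (hH : 0 < H) {g : ℝ → ℝ} (hg : Integrable g) {A : ℝ}
    (hA : ∀ u, A ≤ |u| → g u = 0) :
    Integrable fun z : ℝ × ℝ => g z.1 * g z.2 * |z.1 - z.2| ^ (2 * H) := by
  have h1 : Integrable fun z : ℝ × ℝ => g z.1 * g z.2 := hg.mul_prod hg
  have hm : Measurable fun z : ℝ × ℝ => |z.1 - z.2| ^ (2 * H) :=
    ((measurable_fst.sub measurable_snd).norm).pow_const _
  refine Integrable.mono' (h1.norm.mul_const ((2 * A) ^ (2 * H)))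
    (h1.aestronglyMeasurable.mul hm.aestronglyMeasurable) (Eventually.of_forall fun z => ?_)
  rw [norm_mul, Real.norm_of_nonneg (Real.rpow_nonneg (abs_nonneg _) _)]
  by_cases hz : A ≤ |z.1| ∨ A ≤ |z.2|
  · have : g z.1 * g z.2 = 0 := by rcases hz with h | h <;> simp [hA _ h]
    simp [this]
  · push Not at hz
    have : |z.1 - z.2| ≤ 2 * A := (abs_sub _ _).trans (by linarith)
    gcongr

/-- The energy is positive: in Fourier variables it is `∫ |ĝ(ξ)|² |ξ|^(-1-2H) dξ` up to a positive
constant. -/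
theorem fbmEnergy_pos {H : ℝ} (hH : H ∈ Ioo (0 : ℝ) 1) {g : ℝ → ℝ} (hg : Integrable g) {A : ℝ}
    (hA : ∀ u, A ≤ |u| → g u = 0) (h0 : ∫ x, g x = 0) (hne : ¬ g =ᵐ[volume] 0) :
    0 < fbmEnergy H g := by
  set c := ∫ ξ in Ioi (0 : ℝ), (1 - Real.cos ξ) * ξ ^ (-1 - 2 * H) with hc
  have hc0 : 0 < c := integral_one_sub_cos_pos hH
  set ν := (volume : Measure ℝ).restrict (Ioi 0) with hν
  set C : ℝ → ℝ := fun ξ => ∫ x, g x * Real.cos (ξ * x) with hC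
  set S : ℝ → ℝ := fun ξ => ∫ x, g x * Real.sin (ξ * x) with hS
  set w : ℝ → ℝ := fun ξ => ξ ^ (-1 - 2 * H) with hw
  have hgg : Integrable fun z : ℝ × ℝ => g z.1 * g z.2 := hg.mul_prod hg
  set Φ : (ℝ × ℝ) × ℝ → ℝ := fun y =>
    g y.1.1 * g y.1.2 * ((1 - Real.cos ((y.1.1 - y.1.2) * y.2)) * w y.2) with hΦ
  have inner : ∀ z : ℝ × ℝ, ∫ ξ, Φ (z, ξ) ∂ν = g z.1 * g z.2 * |z.1 - z.2| ^ (2 * H) * c := by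
    intro z
    simp only [hΦ]
    rw [integral_const_mul, integral_one_sub_cos_mul_rpow hH]; ring
  have hΦm : AEStronglyMeasurable Φ ((volume : Measure (ℝ × ℝ)).prod ν) := by
    have h1 : AEStronglyMeasurable (fun y : (ℝ × ℝ) × ℝ => g y.1.1 * g y.1.2)
        ((volume : Measure (ℝ × ℝ)).prod ν) := hgg.aestronglyMeasurable.comp_fst
    exact h1.mul (Measurable.aestronglyMeasurable (by fun_prop))
  have hΦi : Integrable Φ ((volume : Measure (ℝ × ℝ)).prod ν) := by
    rw [integrable_prod_iff hΦm]
    refine ⟨Eventually.of_forall fun z => by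
      simpa only [hΦ] using
        (integrableOn_one_sub_cos_mul_rpow hH (z.1 - z.2)).const_mul (g z.1 * g z.2), ?_⟩
    have : ∀ z : ℝ × ℝ, ∫ ξ, ‖Φ (z, ξ)‖ ∂ν = ‖g z.1 * g z.2 * |z.1 - z.2| ^ (2 * H)‖ * c := by
      intro z
      rw [norm_mul, Real.norm_of_nonneg (Real.rpow_nonneg (abs_nonneg (z.1 - z.2)) (2 * H)),
        mul_assoc, ← integral_one_sub_cos_mul_rpow hH, ← integral_const_mul]
      refine setIntegral_congr_fun measurableSet_Ioi fun ξ hξ => ?_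
      simp only [hΦ, norm_mul]
      rw [Real.norm_of_nonneg (one_sub_cos_nonneg _),
        Real.norm_of_nonneg (Real.rpow_nonneg (le_of_lt hξ) _)]
    simp_rw [this]
    exact (integrable_mul_mul_rpow hH.1 hg hA).norm.mul_const _
  have int_bdd : ∀ {k : ℝ → ℝ}, Continuous k → (∀ x, |k x| ≤ 1) →
      Integrable fun x => g x * k x := by
    intro k hk hk1
    exact hg.mul_bdd (c := 1) hk.aestronglyMeasurable (Eventually.of_forall hk1)
  have hci : ∀ ξ, Integrable fun x => g x * Real.cos (ξ * x) := fun ξ =>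
    int_bdd (by fun_prop) fun x => Real.abs_cos_le_one _
  have hsi : ∀ ξ, Integrable fun x => g x * Real.sin (ξ * x) := fun ξ =>
    int_bdd (by fun_prop) fun x => Real.abs_sin_le_one _
  have outer : ∀ ξ, ∫ z : ℝ × ℝ, Φ (z, ξ) = -((C ξ ^ 2 + S ξ ^ 2) * w ξ) := by
    intro ξ
    have e : ∀ z : ℝ × ℝ, Φ (z, ξ) = (g z.1 * g z.2 -
        (g z.1 * Real.cos (ξ * z.1)) * (g z.2 * Real.cos (ξ * z.2)) -
        (g z.1 * Real.sin (ξ * z.1)) * (g z.2 * Real.sin (ξ * z.2))) * w ξ := by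
      intro z
      simp only [hΦ]
      rw [show (z.1 - z.2) * ξ = ξ * z.1 - ξ * z.2 by ring, Real.cos_sub]
      ring
    simp_rw [e]
    have i2 : Integrable fun z : ℝ × ℝ =>
        (g z.1 * Real.cos (ξ * z.1)) * (g z.2 * Real.cos (ξ * z.2)) := (hci ξ).mul_prod (hci ξ)
    have i3 : Integrable fun z : ℝ × ℝ =>
        (g z.1 * Real.sin (ξ * z.1)) * (g z.2 * Real.sin (ξ * z.2)) := (hsi ξ).mul_prod (hsi ξ)
    have i4 : Integrable fun z : ℝ × ℝ => g z.1 * g z.2 -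
        (g z.1 * Real.cos (ξ * z.1)) * (g z.2 * Real.cos (ξ * z.2)) := hgg.sub i2
    rw [integral_mul_const, integral_sub i4 i3, integral_sub hgg i2]
    have p1 := integral_prod_mul (μ := (volume : Measure ℝ)) (ν := (volume : Measure ℝ)) g g
    have p2 := integral_prod_mul (μ := (volume : Measure ℝ)) (ν := (volume : Measure ℝ))
      (fun x => g x * Real.cos (ξ * x)) (fun x => g x * Real.cos (ξ * x))
    have p3 := integral_prod_mul (μ := (volume : Measure ℝ)) (ν := (volume : Measure ℝ))
      (fun x => g x * Real.sin (ξ * x)) (fun x => g x * Real.sin (ξ * x))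
    rw [← Measure.volume_eq_prod] at p1 p2 p3
    rw [p1, p2, p3, h0]
    simp only [hC, hS]
    ring
  have swap := integral_integral_swap (f := fun z ξ => Φ (z, ξ)) hΦi
  simp only [inner, outer] at swap
  rw [integral_mul_const, integral_neg] at swap
  have hwi : Integrable (fun ξ => (C ξ ^ 2 + S ξ ^ 2) * w ξ) ν := by
    have := hΦi.integral_prod_right
    simp only [outer] at this
    simpa using this.neg
  have hnn : ∀ᵐ ξ ∂ν, 0 ≤ (C ξ ^ 2 + S ξ ^ 2) * w ξ := by
    filter_upwards [ae_restrict_mem measurableSet_Ioi] with ξ hξ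
    exact mul_nonneg (by positivity) (Real.rpow_nonneg (le_of_lt hξ) _)
  have hle : 0 ≤ ∫ ξ, (C ξ ^ 2 + S ξ ^ 2) * w ξ ∂ν := integral_nonneg_of_ae hnn
  have hnz : ∫ ξ, (C ξ ^ 2 + S ξ ^ 2) * w ξ ∂ν ≠ 0 := by
    intro hz
    rw [integral_eq_zero_iff_of_nonneg_ae hnn hwi] at hz
    have hCc : Continuous C := by
      refine continuous_of_dominated (bound := fun x => |g x|)
        (fun ξ => (hci ξ).aestronglyMeasurable) (fun ξ => Eventually.of_forall fun x => ?_) hg.abs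
        (Eventually.of_forall fun x => by fun_prop)
      rw [norm_mul]
      exact mul_le_of_le_one_right (abs_nonneg _) (Real.abs_cos_le_one _)
    have hSc : Continuous S := by
      refine continuous_of_dominated (bound := fun x => |g x|)
        (fun ξ => (hsi ξ).aestronglyMeasurable) (fun ξ => Eventually.of_forall fun x => ?_) hg.abs
        (Eventually.of_forall fun x => by fun_prop)
      rw [norm_mul]
      exact mul_le_of_le_one_right (abs_nonneg _) (Real.abs_sin_le_one _)
    have hz' : (fun ξ => C ξ ^ 2 + S ξ ^ 2) =ᵐ[ν] 0 := by
      filter_upwards [hz, ae_restrict_mem measurableSet_Ioi] with ξ h hξ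
      exact (mul_eq_zero.1 h).resolve_right (Real.rpow_pos_of_pos hξ _).ne'
    have hall : ∀ ξ : ℝ, 0 < ξ → C ξ ^ 2 + S ξ ^ 2 = 0 := fun ξ hξ =>
      Measure.eqOn_open_of_ae_eq (f := fun ξ => C ξ ^ 2 + S ξ ^ 2) (g := 0) hz' isOpen_Ioi
        ((hCc.pow 2).add (hSc.pow 2)).continuousOn continuousOn_const hξ
    refine hne (ae_eq_zero_of_cos_sin hg (fun ξ hξ => ?_) (fun ξ hξ => ?_) h0)
    · have : C ξ = 0 := by nlinarith [hall ξ hξ, sq_nonneg (C ξ), sq_nonneg (S ξ)]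
      exact this
    · have : S ξ = 0 := by nlinarith [hall ξ hξ, sq_nonneg (C ξ), sq_nonneg (S ξ)]
      exact this
  have hpos := lt_of_le_of_ne hle (Ne.symm hnz)
  rw [fbmEnergy]
  have : (∫ z : ℝ × ℝ, g z.1 * g z.2 * |z.1 - z.2| ^ (2 * H)) < 0 := by
    by_contra hcon
    push Not at hcon
    have := mul_nonneg hcon hc0.le
    rw [swap] at this
    linarith
  linarith

/-! ### Small ball estimate for weighted integrals of fractional Brownian motion -/

/-- The `i`-th point of the grid dividing `[-A, A]` into `n + 1` equal cells. -/
noncomputable def cellPoint (A : ℝ) (n i : ℕ) : ℝ := -A + i * (2 * A / (n + 1))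

/-- The integral of `g` over the `i`-th of the `n + 1` equal cells of `[-A, A]`. -/
noncomputable def cellMass (g : ℝ → ℝ) (A : ℝ) (n i : ℕ) : ℝ :=
  ∫ x in cellPoint A n i..cellPoint A n (i + 1), g x

lemma cellPoint_zero (A : ℝ) (n : ℕ) : cellPoint A n 0 = -A := by simp [cellPoint]

lemma cellPoint_last (A : ℝ) (n : ℕ) : cellPoint A n (n + 1) = A := by
  rw [cellPoint]; push_cast; field_simp; ring

lemma cellPoint_succ (A : ℝ) (n i : ℕ) :
    cellPoint A n (i + 1) = cellPoint A n i + 2 * A / (n + 1) := by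
  rw [cellPoint, cellPoint]; push_cast; ring

lemma cellPoint_mono {A : ℝ} (hA : 0 ≤ A) (n : ℕ) : Monotone (cellPoint A n) :=
  monotone_nat_of_le_succ fun i => by
    rw [cellPoint_succ]; have : 0 ≤ 2 * A / (n + 1) := by positivity
    linarith

lemma cellPoint_mem {A : ℝ} (hA : 0 ≤ A) {n i : ℕ} (hi : i ≤ n + 1) :
    cellPoint A n i ∈ Icc (-A) A := by
  constructor
  · rw [← cellPoint_zero A n]; exact cellPoint_mono hA n (Nat.zero_le i)
  · conv_rhs => rw [← cellPoint_last A n]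
    exact cellPoint_mono hA n hi

section Approximation

variable {g : ℝ → ℝ} {A : ℝ}

lemma sum_abs_cellMass_le (hg : Integrable g) (hA : 0 ≤ A) (n : ℕ) :
    ∑ i ∈ Finset.range (n + 1), |cellMass g A n i| ≤ ∫ x, |g x| := by
  have h1 : ∀ i, |cellMass g A n i| ≤ ∫ x in cellPoint A n i..cellPoint A n (i + 1), |g x| :=
    fun i => intervalIntegral.abs_integral_le_integral_abs (cellPoint_mono hA n (Nat.le_succ i))
  refine (Finset.sum_le_sum fun i _ => h1 i).trans ?_
  rw [intervalIntegral.sum_integral_adjacent_intervals fun k _ => hg.abs.intervalIntegrable,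
    cellPoint_zero, cellPoint_last, intervalIntegral.integral_of_le (by linarith)]
  exact setIntegral_le_integral hg.abs (Eventually.of_forall fun x => abs_nonneg _)

lemma integral_eq_intervalIntegral (hgA : ∀ u, A ≤ |u| → g u = 0) (b : ℝ → ℝ) :
    ∫ x, g x * b x = ∫ x in (-A)..A, g x * b x := by
  refine (intervalIntegral.integral_eq_integral_of_support_subset fun x hx => ?_).symm
  by_contra hc
  refine hx ?_
  simp only
  rw [hgA x, zero_mul]
  by_contra hlt
  push Not at hlt
  rw [abs_lt] at hlt
  exact hc ⟨hlt.1, hlt.2.le⟩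

lemma sum_cellMass (hg : Integrable g) (hgA : ∀ u, A ≤ |u| → g u = 0) (n : ℕ) :
    ∑ i ∈ Finset.range (n + 1), cellMass g A n i = ∫ x, g x := by
  have := integral_eq_intervalIntegral hgA (fun _ => 1)
  simp only [mul_one] at this
  rw [this]
  refine (intervalIntegral.sum_integral_adjacent_intervals
    fun k _ => hg.intervalIntegrable).trans ?_
  rw [cellPoint_zero, cellPoint_last]

/-- The error of the weighted Riemann sum is controlled by the oscillation of `b` on the cells. -/
lemma abs_sum_cellMass_sub_le (hg : Integrable g) (hA : 0 ≤ A) (hgA : ∀ u, A ≤ |u| → g u = 0)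
    {b : ℝ → ℝ} (hb : ContinuousOn b (Icc (-A) A)) {n : ℕ} {ε : ℝ}
    (hε : ∀ x ∈ Icc (-A) A, ∀ y ∈ Icc (-A) A, |x - y| ≤ 2 * A / (n + 1) → |b x - b y| ≤ ε) :
    |∑ i ∈ Finset.range (n + 1), cellMass g A n i * b (cellPoint A n i) - ∫ x, g x * b x| ≤
      ε * ∫ x, |g x| := by
  have hgb : IntegrableOn (fun x => g x * b x) (Icc (-A) A) :=
    hg.integrableOn.mul_continuousOn hb isCompact_Icc
  have sub : ∀ i < n + 1, uIcc (cellPoint A n i) (cellPoint A n (i + 1)) ⊆ Icc (-A) A :=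
    fun i hi => by
      rw [uIcc_of_le (cellPoint_mono hA n (Nat.le_succ i))]
      exact Icc_subset_Icc (cellPoint_mem hA (by omega)).1 (cellPoint_mem hA (by omega)).2
  have hii : ∀ i < n + 1, IntervalIntegrable (fun x => g x * b x) volume (cellPoint A n i)
      (cellPoint A n (i + 1)) := fun i hi => (hgb.mono_set (sub i hi)).intervalIntegrable
  rw [integral_eq_intervalIntegral hgA, show (∫ x in (-A)..A, g x * b x) =
      ∑ i ∈ Finset.range (n + 1), ∫ x in cellPoint A n i..cellPoint A n (i + 1), g x * b x by
    rw [intervalIntegral.sum_integral_adjacent_intervals hii, cellPoint_zero, cellPoint_last],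
    ← Finset.sum_sub_distrib]
  have hε0 : 0 ≤ ε := (abs_nonneg _).trans
    (hε 0 ⟨by linarith, hA⟩ 0 ⟨by linarith, hA⟩ (by rw [sub_self, abs_zero]; positivity))
  have term : ∀ i ∈ Finset.range (n + 1), |cellMass g A n i * b (cellPoint A n i) -
      ∫ x in cellPoint A n i..cellPoint A n (i + 1), g x * b x| ≤
      ∫ x in cellPoint A n i..cellPoint A n (i + 1), |g x| * ε := by
    intro i hi
    have hi := Finset.mem_range.1 hi
    have hmono := cellPoint_mono hA n (Nat.le_succ i)
    rw [cellMass, ← intervalIntegral.integral_mul_const,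
      ← intervalIntegral.integral_sub (hg.intervalIntegrable.mul_const _) (hii i hi),
      ← Real.norm_eq_abs]
    refine intervalIntegral.norm_integral_le_of_norm_le hmono
      (Eventually.of_forall fun x hx => ?_) (hg.abs.intervalIntegrable.mul_const _)
    rw [← mul_sub, norm_mul, Real.norm_eq_abs, Real.norm_eq_abs]
    refine mul_le_mul_of_nonneg_left (hε _ (cellPoint_mem hA (by omega)) _ ?_ ?_) (abs_nonneg _)
    · exact sub i hi (by rw [uIcc_of_le hmono]; exact Ioc_subset_Icc_self hx)
    · rw [cellPoint_succ] at hx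
      rw [abs_sub_comm, abs_of_nonneg (by linarith [hx.1])]
      linarith [hx.2]
  refine (Finset.abs_sum_le_sum_abs _ _).trans ((Finset.sum_le_sum term).trans ?_)
  rw [intervalIntegral.sum_integral_adjacent_intervals
    (fun k _ => hg.abs.intervalIntegrable.mul_const _), cellPoint_zero, cellPoint_last,
    intervalIntegral.integral_mul_const, mul_comm, intervalIntegral.integral_of_le (by linarith)]
  exact mul_le_mul_of_nonneg_left
    (setIntegral_le_integral hg.abs (Eventually.of_forall fun x => abs_nonneg _)) hε0

lemma eventually_cell_lt {A δ : ℝ} (hδ : 0 < δ) :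
    ∀ᶠ n : ℕ in atTop, 2 * A / ((n : ℝ) + 1) < δ := by
  have h : Tendsto (fun n : ℕ => 2 * A / ((n : ℝ) + 1)) atTop (nhds 0) :=
    tendsto_const_nhds.div_atTop
      (tendsto_atTop_add_const_right _ _ tendsto_natCast_atTop_atTop)
  exact h.eventually (gt_mem_nhds hδ)

lemma tendsto_sum_cellMass (hg : Integrable g) (hA : 0 ≤ A) (hgA : ∀ u, A ≤ |u| → g u = 0)
    {b : ℝ → ℝ} (hb : ContinuousOn b (Icc (-A) A)) :
    Tendsto (fun n : ℕ => ∑ i ∈ Finset.range (n + 1), cellMass g A n i * b (cellPoint A n i)) atTop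
      (nhds (∫ x, g x * b x)) := by
  rw [Metric.tendsto_nhds]
  intro ε hε
  have hG : 0 ≤ ∫ x, |g x| := integral_nonneg fun x => abs_nonneg _
  obtain ⟨δ, hδ, H⟩ := Metric.uniformContinuousOn_iff.1
    (isCompact_Icc.uniformContinuousOn_of_continuous hb) (ε / ((∫ x, |g x|) + 1)) (by positivity)
  filter_upwards [eventually_cell_lt (A := A) hδ] with n hn
  refine (abs_sum_cellMass_sub_le hg hA hgA hb fun x hx y hy hxy =>
    (H x hx y hy (hxy.trans_lt hn)).le).trans_lt ?_
  rw [div_mul_eq_mul_div, div_lt_iff₀ (by positivity)]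
  nlinarith

/-- The discretized energies converge to the energy. -/
lemma tendsto_discrete_energy {H : ℝ} (hH : 0 < H) (hg : Integrable g) (hA : 0 ≤ A)
    (hgA : ∀ u, A ≤ |u| → g u = 0) :
    Tendsto (fun n : ℕ => -(∑ i ∈ Finset.range (n + 1), ∑ j ∈ Finset.range (n + 1),
      cellMass g A n i * cellMass g A n j * |cellPoint A n i - cellPoint A n j| ^ (2 * H)) / 2)
      atTop (nhds (fbmEnergy H g)) := by
  have hH2 : 0 ≤ 2 * H := by positivity
  have hk : Continuous fun x : ℝ => |x| ^ (2 * H) :=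
    continuous_abs.rpow_const fun _ => Or.inr hH2
  set h : ℝ → ℝ := fun u => ∫ v, g v * |u - v| ^ (2 * H) with hh
  have hcont : ContinuousOn h (Icc (-A) A) := by
    refine continuousOn_of_dominated (bound := fun v => |g v| * (2 * A) ^ (2 * H))
      (fun u _ => hg.aestronglyMeasurable.mul (Continuous.aestronglyMeasurable (by
        exact hk.comp (continuous_const.sub continuous_id)))) (fun u hu => ?_)
      (hg.abs.mul_const _) (Eventually.of_forall fun v => ?_)
    · refine Eventually.of_forall fun v => ?_
      rw [norm_mul, Real.norm_eq_abs, Real.norm_of_nonneg (Real.rpow_nonneg (abs_nonneg _) _)]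
      rcases le_or_gt A |v| with hv | hv
      · simp [hgA v hv]
      · have : |u - v| ≤ 2 * A := by
          have := abs_le.2 hu
          exact (abs_sub _ _).trans (by linarith)
        gcongr
    · exact (continuous_const.mul (hk.comp (continuous_id.sub continuous_const))).continuousOn
  have hE : fbmEnergy H g = -(∫ u, g u * h u) / 2 := by
    rw [fbmEnergy, Measure.volume_eq_prod, integral_prod _ (by
      rw [← Measure.volume_eq_prod]; exact integrable_mul_mul_rpow hH hg hgA)]
    simp only [hh, mul_assoc, integral_const_mul]
  rw [hE]
  refine Tendsto.div_const (Tendsto.neg ?_) 2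
  have h1 := tendsto_sum_cellMass hg hA hgA hcont
  have h2 : Tendsto (fun n : ℕ => ∑ i ∈ Finset.range (n + 1), ∑ j ∈ Finset.range (n + 1),
      cellMass g A n i * cellMass g A n j * |cellPoint A n i - cellPoint A n j| ^ (2 * H) -
      ∑ i ∈ Finset.range (n + 1), cellMass g A n i * h (cellPoint A n i)) atTop (nhds 0) := by
    rw [Metric.tendsto_nhds]
    intro ε hε
    have hG : 0 ≤ ∫ x, |g x| := integral_nonneg fun x => abs_nonneg _
    set G := ∫ x, |g x| with hGdef
    obtain ⟨δ, hδ, Hu⟩ := Metric.uniformContinuousOn_iff.1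
      ((isCompact_Icc (a := -(2 * A)) (b := 2 * A)).uniformContinuousOn_of_continuous
        hk.continuousOn) (ε / (G * G + 1)) (by positivity)
    filter_upwards [eventually_cell_lt (A := A) hδ] with n hn
    rw [dist_zero_right, Real.norm_eq_abs, ← Finset.sum_sub_distrib]
    have term : ∀ i ∈ Finset.range (n + 1), |∑ j ∈ Finset.range (n + 1),
        cellMass g A n i * cellMass g A n j * |cellPoint A n i - cellPoint A n j| ^ (2 * H) -
        cellMass g A n i * h (cellPoint A n i)| ≤ |cellMass g A n i| * (ε / (G * G + 1) * G) := by
      intro i hi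
      have hi := Finset.mem_range.1 hi
      have hm := cellPoint_mem hA (n := n) (i := i) (by omega)
      simp_rw [mul_assoc]
      rw [← Finset.mul_sum, ← mul_sub, abs_mul]
      refine mul_le_mul_of_nonneg_left ?_ (abs_nonneg _)
      refine abs_sum_cellMass_sub_le (b := fun v => |cellPoint A n i - v| ^ (2 * H)) hg hA hgA
        (hk.comp (continuous_const.sub continuous_id)).continuousOn fun x hx y hy hxy => ?_
      refine (Hu _ ⟨by linarith [hm.1, hx.2], by linarith [hm.2, hx.1]⟩ _
        ⟨by linarith [hm.1, hy.2], by linarith [hm.2, hy.1]⟩ ?_).le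
      rw [Real.dist_eq, show cellPoint A n i - x - (cellPoint A n i - y) = y - x by ring,
        abs_sub_comm]
      exact hxy.trans_lt hn
    refine (Finset.abs_sum_le_sum_abs _ _).trans_lt ((Finset.sum_le_sum term).trans_lt ?_)
    rw [← Finset.sum_mul]
    calc _ ≤ G * (ε / (G * G + 1) * G) := by
          refine mul_le_mul_of_nonneg_right (sum_abs_cellMass_le hg hA n) (by positivity)
      _ = ε * (G * G) / (G * G + 1) := by ring
      _ < ε := by
          rw [div_lt_iff₀ (by positivity)]
          nlinarith
  have h3 := h2.add h1
  simpa using h3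

end Approximation

/-- A centered Gaussian variable of variance `v` has density at most `1 / √(2 π v)`. -/
lemma measure_abs_lt_le_of_hasGaussianLaw {Ω : Type*} [MeasurableSpace Ω] {P : Measure Ω}
    {X : Ω → ℝ} (hX : HasGaussianLaw X P) (h0 : ∫ ω, X ω ∂P = 0) {v : ℝ} (hv : 0 < v)
    (h2 : ∫ ω, X ω ^ 2 ∂P = v) {δ : ℝ} (hδ : 0 ≤ δ) :
    P {ω | |X ω| < δ} ≤ ENNReal.ofReal (δ / √v) := by
  have e : P {ω | |X ω| < δ} = P.map X (Ioo (-δ) δ) := by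
    rw [Measure.map_apply_of_aemeasurable hX.aemeasurable measurableSet_Ioo]
    congr 1; ext ω; simp [abs_lt]
  have hv' : v.toNNReal ≠ 0 := by simpa using hv
  rw [e, hX.map_eq_gaussianReal, h0, variance_of_integral_eq_zero hX.aemeasurable h0, h2,
    gaussianReal_apply _ hv']
  have bound : ∀ x, gaussianPDF 0 v.toNNReal x ≤ ENNReal.ofReal ((√(2 * Real.pi * v))⁻¹) := by
    intro x
    refine ENNReal.ofReal_le_ofReal ?_
    rw [gaussianPDFReal, Real.coe_toNNReal _ hv.le]
    refine mul_le_of_le_one_right (by positivity) (Real.exp_le_one_iff.2 ?_)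
    rw [neg_div, neg_nonpos]; positivity
  calc _ ≤ ∫⁻ _ in Ioo (-δ) δ, ENNReal.ofReal ((√(2 * Real.pi * v))⁻¹) :=
        lintegral_mono fun x => bound x
    _ = ENNReal.ofReal ((√(2 * Real.pi * v))⁻¹ * (δ - -δ)) := by
        rw [setLIntegral_const, Real.volume_Ioo, ENNReal.ofReal_mul (by positivity)]
    _ ≤ _ := by
        refine ENNReal.ofReal_le_ofReal ?_
        rw [Real.sqrt_mul (by positivity), mul_inv, div_eq_mul_inv]
        have h1 : (√(2 * Real.pi))⁻¹ ≤ 1 / 2 := by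
          rw [one_div]
          refine inv_anti₀ (by norm_num) (Real.le_sqrt_of_sq_le ?_)
          linarith [Real.pi_gt_three]
        have h3 : 0 ≤ (√v)⁻¹ := by positivity
        calc _ = (√(2 * Real.pi))⁻¹ * (2 * δ * (√v)⁻¹) := by ring
          _ ≤ 1 / 2 * (2 * δ * (√v)⁻¹) := by gcongr
          _ = _ := by ring

/-- If `X_n → X` almost surely, small ball bounds for the `X_n` pass to the limit. -/
lemma measure_abs_lt_le_of_tendsto {Ω : Type*} [MeasurableSpace Ω] {P : Measure Ω}
    {X : Ω → ℝ} {Y : ℕ → Ω → ℝ} (h : ∀ᵐ ω ∂P, Tendsto (fun n => Y n ω) atTop (nhds (X ω)))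
    {δ : ℝ} {a : ℕ → ENNReal} {l : ENNReal} (ha : Tendsto a atTop (nhds l))
    (hY : ∀ᶠ n in atTop, P {ω | |Y n ω| < δ} ≤ a n) : P {ω | |X ω| < δ} ≤ l := by
  set D : ℕ → Set Ω := fun N => {ω | ∀ n ≥ N, |Y n ω| < δ} with hD
  have mono : Monotone D := fun N M hNM ω hω n hn => hω n (le_trans hNM hn)
  have h1 : {ω | |X ω| < δ} ≤ᵐ[P] ⋃ N, D N := by
    filter_upwards [h] with ω hω hX
    exact mem_iUnion.2 (eventually_atTop.1 (hω.abs.eventually (gt_mem_nhds hX)))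
  refine (measure_mono_ae h1).trans ?_
  rw [mono.measure_iUnion]
  refine iSup_le fun N => ge_of_tendsto ha ?_
  filter_upwards [hY, eventually_ge_atTop N] with n hn hNn
  exact (measure_mono fun ω (hω : ω ∈ D N) => hω n hNn).trans hn

namespace IsFractionalBrownianMotion

variable {Ω : Type*} [MeasurableSpace Ω] {P : Measure Ω} {H : ℝ} {B : ℝ≥0 → Ω → ℝ}

/-- The variance of a linear combination whose coefficients sum to zero depends only on the
increments of the times. -/
lemma integral_sum_sq [IsProbabilityMeasure P] (hB : IsFractionalBrownianMotion H B P)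
    (s : Finset ℕ) (c : ℕ → ℝ) (hc : ∑ i ∈ s, c i = 0) (t : ℕ → ℝ≥0) :
    ∫ ω, (∑ i ∈ s, c i * B (t i) ω) ^ 2 ∂P =
      -(∑ i ∈ s, ∑ j ∈ s, c i * c j * |(t i : ℝ) - t j| ^ (2 * H)) / 2 := by
  have e : ∀ ω, (∑ i ∈ s, c i * B (t i) ω) ^ 2 =
      ∑ i ∈ s, ∑ j ∈ s, c i * c j * (B (t j) ω * B (t i) ω) := by
    intro ω
    rw [sq, Finset.sum_mul_sum]
    refine Finset.sum_congr rfl fun i _ => Finset.sum_congr rfl fun j _ => by ring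
  have hi : ∀ i j, Integrable (fun ω => c i * c j * (B (t j) ω * B (t i) ω)) P :=
    fun i j => (hB.integrable_mul _ _).const_mul _
  simp_rw [e]
  rw [integral_finsetSum _ fun i _ => integrable_finsetSum _ fun j _ => hi i j]
  simp_rw [integral_finsetSum _ fun j _ => hi _ j, integral_const_mul, hB.covariance]
  have split : ∀ i j, c i * c j * (((t j : ℝ) ^ (2 * H) + (t i : ℝ) ^ (2 * H) -
      |(t j : ℝ) - t i| ^ (2 * H)) / 2) = c i * (c j * (t j : ℝ) ^ (2 * H) / 2) +
      c j * (c i * (t i : ℝ) ^ (2 * H) / 2) - c i * c j * |(t i : ℝ) - t j| ^ (2 * H) / 2 := by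
    intro i j; rw [abs_sub_comm]; ring
  simp_rw [split, Finset.sum_sub_distrib, Finset.sum_add_distrib, ← Finset.mul_sum,
    ← Finset.sum_mul, hc]
  simp_rw [← Finset.sum_div]
  rw [← Finset.mul_sum]
  simp [neg_div]

/-- **Small ball estimate**: the density of `∫ g(u) B(x + r u) du` is at most of order
`r ^ (-H)`. -/
theorem measure_abs_integral_lt_le [IsProbabilityMeasure P]
    (hB : IsFractionalBrownianMotion H B P) (hH : 0 < H) {g : ℝ → ℝ} {A : ℝ}
    (hg : Integrable g) (hA : 0 ≤ A) (hgA : ∀ u, A ≤ |u| → g u = 0) (h0 : ∫ x, g x = 0)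
    (hE : 0 < fbmEnergy H g) {x r : ℝ} (hr : 0 < r) (hx : r * A ≤ x) {δ : ℝ} (hδ : 0 ≤ δ) :
    P {ω | |∫ u, g u * B (x + r * u).toNNReal ω| < r ^ H * δ} ≤
      ENNReal.ofReal (δ / √(fbmEnergy H g)) := by
  set t : ℕ → ℕ → ℝ≥0 := fun n i => (x + r * cellPoint A n i).toNNReal with ht
  set e : ℕ → ℝ := fun n => -(∑ i ∈ Finset.range (n + 1), ∑ j ∈ Finset.range (n + 1),
      cellMass g A n i * cellMass g A n j * |cellPoint A n i - cellPoint A n j| ^ (2 * H)) / 2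
  have he : Tendsto e atTop (nhds (fbmEnergy H g)) := tendsto_discrete_energy hH hg hA hgA
  set Y : ℕ → Ω → ℝ := fun n ω => ∑ i ∈ Finset.range (n + 1), cellMass g A n i * B (t n i) ω
  have hgauss : ∀ n, HasGaussianLaw (Y n) P := fun n => by
    have h := ((hB.gaussian.comp_right (t n)).smul (cellMass g A n)).hasGaussianLaw_fun_sum
      (I := Finset.range (n + 1))
    simpa only [smul_eq_mul, Function.comp_apply] using h
  have hmean : ∀ n, ∫ ω, Y n ω ∂P = 0 := fun n => by
    rw [integral_finsetSum _ fun i _ =>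
      (hB.gaussian.hasGaussianLaw_eval _).integrable.const_mul _]
    simp [integral_const_mul, hB.centered]
  have hvar : ∀ n, ∫ ω, Y n ω ^ 2 ∂P = (r ^ H) ^ 2 * e n := fun n => by
    rw [hB.integral_sum_sq _ _ (by rw [sum_cellMass hg hgA, h0]) (t n)]
    simp only [e]
    rw [mul_div_assoc', mul_neg, Finset.mul_sum]
    congr 2
    refine Finset.sum_congr rfl fun i hi => ?_
    rw [Finset.mul_sum]
    refine Finset.sum_congr rfl fun j hj => ?_
    have nn : ∀ i ∈ Finset.range (n + 1), (t n i : ℝ) = x + r * cellPoint A n i := fun i hi => by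
      have := (cellPoint_mem hA (n := n) (i := i) (by have := Finset.mem_range.1 hi; omega)).1
      exact Real.coe_toNNReal _ (by nlinarith)
    rw [nn i hi, nn j hj, show x + r * cellPoint A n i - (x + r * cellPoint A n j) =
      r * (cellPoint A n i - cellPoint A n j) by ring, abs_mul, abs_of_pos hr,
      Real.mul_rpow hr.le (abs_nonneg _), mul_comm 2 H, Real.rpow_mul hr.le,
      ← Real.rpow_natCast (r ^ H) 2]
    push_cast; ring
  have hrH : 0 < r ^ H := Real.rpow_pos_of_pos hr _
  refine measure_abs_lt_le_of_tendsto (Y := Y)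
    (a := fun n => ENNReal.ofReal (r ^ H * δ / √((r ^ H) ^ 2 * e n))) ?_ ?_ ?_
  · filter_upwards [hB.ae_continuous] with ω hω
    exact tendsto_sum_cellMass hg hA hgA (b := fun u => B (x + r * u).toNNReal ω)
      (hω.comp (by fun_prop : Continuous fun u => x + r * u)).continuousOn
  · refine ENNReal.tendsto_ofReal ?_
    have h1 : Tendsto (fun n => r ^ H * δ / √((r ^ H) ^ 2 * e n)) atTop
        (nhds (r ^ H * δ / √((r ^ H) ^ 2 * fbmEnergy H g))) :=
      tendsto_const_nhds.div ((tendsto_const_nhds.mul he).sqrt) (by positivity)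
    rwa [Real.sqrt_mul (by positivity), Real.sqrt_sq hrH.le, mul_div_mul_left _ _ hrH.ne'] at h1
  · filter_upwards [he.eventually (lt_mem_nhds hE)] with n hn
    exact measure_abs_lt_le_of_hasGaussianLaw (hgauss n) (hmean n) (by positivity) (hvar n)
      (by positivity)

end IsFractionalBrownianMotion

/-- If the events `E n k`, `k ∈ W n`, have probability at most `p n` with `∑ p n < ∞`, then almost
surely, for large `n`, at least half of them do not occur. Neither independence nor measurability
is needed: the expected number of occurring events is at most `p n` times their number. -/
lemma ae_eventually_half_notMem {Ω : Type*} [MeasurableSpace Ω] {P : Measure Ω}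
    {W : ℕ → Finset ℕ} {E : ℕ → ℕ → Set Ω} {p : ℕ → ENNReal} (hp : ∑' n, p n ≠ ⊤)
    (hE : ∀ n k, P (E n k) ≤ p n) :
    ∀ᵐ ω ∂P, ∀ᶠ n in atTop, ∃ G ⊆ W n, (W n).card ≤ 2 * G.card ∧ ∀ k ∈ G, ω ∉ E n k := by
  classical
  set f : ℕ → Ω → ENNReal := fun n ω =>
    ∑ k ∈ W n, (toMeasurable P (E n k)).indicator (fun _ => 1) ω with hf
  set F : ℕ → Set Ω := fun n => {ω | ((W n).card : ENNReal) < 2 * f n ω} with hF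
  have fm : ∀ n, Measurable (f n) := fun n =>
    Finset.measurable_fun_sum _ fun k _ =>
      measurable_const.indicator (measurableSet_toMeasurable _ _)
  have hint : ∀ n, ∫⁻ ω, f n ω ∂P ≤ (W n).card * p n := by
    intro n
    rw [lintegral_finsetSum _ fun k _ =>
      measurable_const.indicator (measurableSet_toMeasurable _ _)]
    refine (Finset.sum_le_card_nsmul _ _ (p n) fun k _ => ?_).trans (by rw [nsmul_eq_mul])
    rw [lintegral_indicator_const (measurableSet_toMeasurable _ _), one_mul, measure_toMeasurable]
    exact hE n k
  have hPF : ∀ n, P (F n) ≤ 2 * p n := by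
    intro n
    rcases (W n).eq_empty_or_nonempty with h | h
    · simp [hF, hf, h]
    have hc0 : ((W n).card : ENNReal) ≠ 0 := by simpa using h.ne_empty
    have hct : ((W n).card : ENNReal) ≠ ⊤ := ENNReal.natCast_ne_top _
    have hle : F n ⊆ {ω | ((W n).card : ENNReal) ≤ 2 * f n ω} := fun ω hω => by
      simp only [hF, mem_ofPred_eq] at hω ⊢
      exact hω.le
    have h1 : (W n).card * P (F n) ≤ (W n).card * (2 * p n) := by
      calc _ ≤ (W n).card * P {ω | ((W n).card : ENNReal) ≤ 2 * f n ω} := by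
            exact mul_le_mul_right (measure_mono hle) _
        _ ≤ ∫⁻ ω, 2 * f n ω ∂P := mul_meas_ge_le_lintegral ((fm n).const_mul 2) _
        _ = 2 * ∫⁻ ω, f n ω ∂P := lintegral_const_mul _ (fm n)
        _ ≤ 2 * ((W n).card * p n) := by gcongr; exact hint n
        _ = _ := by ring
    exact (ENNReal.mul_le_mul_iff_right hc0 hct).1 h1
  have hsum : ∑' n, P (F n) ≠ ⊤ := by
    refine ne_top_of_le_ne_top ?_ (ENNReal.tsum_le_tsum hPF)
    rw [ENNReal.tsum_mul_left]
    exact ENNReal.mul_ne_top (by simp) hp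
  filter_upwards [ae_eventually_notMem hsum] with ω hω
  filter_upwards [hω] with n hn
  refine ⟨(W n).filter fun k => ω ∉ E n k, Finset.filter_subset _ _, ?_,
    fun k hk => (Finset.mem_filter.1 hk).2⟩
  have hbad : (((W n).filter fun k => ω ∈ E n k).card : ENNReal) ≤ f n ω := by
    rw [Finset.card_filter]
    push_cast
    refine Finset.sum_le_sum fun k _ => ?_
    split_ifs with h
    · rw [indicator_of_mem (subset_toMeasurable _ _ h)]
    · exact zero_le
  have h2 : 2 * ((W n).filter fun k => ω ∈ E n k).card ≤ (W n).card := by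
    simp only [hF, mem_ofPred_eq, not_lt] at hn
    have := (mul_le_mul_right hbad 2).trans hn
    exact_mod_cast this
  have := Finset.card_filter_add_card_filter_not (s := W n) (fun k => ω ∈ E n k)
  omega

namespace IsFractionalBrownianMotion

variable {Ω : Type*} [MeasurableSpace Ω] {P : Measure Ω} {H : ℝ} {B : ℝ≥0 → Ω → ℝ}

/-- Almost surely, at every sufficiently fine scale `r = 2 ^ (-n)`, at least half of the detail
coefficients of `B` with position `r k ∈ [a, b]` are not much smaller than `r ^ H`. -/
theorem ae_eventually_half_large [IsProbabilityMeasure P]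
    (hB : IsFractionalBrownianMotion H B P) (hH : 0 < H) {g : ℝ → ℝ} {A : ℝ}
    (hg : Integrable g) (hA : 0 ≤ A) (hgA : ∀ u, A ≤ |u| → g u = 0) (h0 : ∫ x, g x = 0)
    (hE : 0 < fbmEnergy H g) {a b ε : ℝ} (ha : 0 < a) (hε : 0 < ε) :
    ∀ᵐ ω ∂P, ∀ᶠ n : ℕ in atTop, ∃ G ⊆ Finset.Icc ⌈a * 2 ^ n⌉₊ ⌊b * 2 ^ n⌋₊,
      (Finset.Icc ⌈a * 2 ^ n⌉₊ ⌊b * 2 ^ n⌋₊).card ≤ 2 * G.card ∧ ∀ k ∈ G,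
        ((1 / 2 : ℝ) ^ n) ^ (H + ε) ≤
          |∫ u, g u * B ((1 / 2 : ℝ) ^ n * k + (1 / 2 : ℝ) ^ n * u).toNNReal ω| := by
  set r : ℕ → ℝ := fun n => (1 / 2 : ℝ) ^ n with hr
  have r0 : ∀ n, 0 < r n := fun n => by positivity
  set ρ : ℝ := (1 / 2 : ℝ) ^ ε with hρ
  have ρ0 : 0 < ρ := by positivity
  have ρ1 : ρ < 1 := Real.rpow_lt_one (by norm_num) (by norm_num) hε
  -- the condition `A ≤ k` keeps the support of the coefficient inside the positive half-line
  set E : ℕ → ℕ → Set Ω := fun n k =>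
    {ω | A ≤ k ∧ |∫ u, g u * B (r n * k + r n * u).toNNReal ω| < r n ^ H * r n ^ ε} with hEdef
  have hP : ∀ n k, P (E n k) ≤ ENNReal.ofReal (ρ ^ n / √(fbmEnergy H g)) := by
    intro n k
    by_cases hk : A ≤ k
    · simp only [hEdef, hk, true_and]
      rw [← half_pow_rpow n ε]
      exact hB.measure_abs_integral_lt_le hH hg hA hgA h0 hE (r0 n)
        (mul_le_mul_of_nonneg_left hk (r0 n).le) (Real.rpow_nonneg (r0 n).le _)
    · simp [hEdef, hk]
  have hsum : ∑' n, ENNReal.ofReal (ρ ^ n / √(fbmEnergy H g)) ≠ ⊤ := by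
    rw [← ENNReal.ofReal_tsum_of_nonneg (fun n => by positivity)
      ((summable_geometric_of_lt_one ρ0.le ρ1).div_const _)]
    exact ENNReal.ofReal_ne_top
  have hlarge : ∀ᶠ n : ℕ in atTop, A ≤ a * 2 ^ n :=
    ((tendsto_pow_atTop_atTop_of_one_lt
      (one_lt_two (α := ℝ))).const_mul_atTop ha).eventually_ge_atTop A
  filter_upwards [ae_eventually_half_notMem
    (W := fun n => Finset.Icc ⌈a * 2 ^ n⌉₊ ⌊b * 2 ^ n⌋₊) hsum hP] with ω hω
  filter_upwards [hω, hlarge] with n ⟨G, hG, hc, hbad⟩ hn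
  refine ⟨G, hG, hc, fun k hk => ?_⟩
  have hAk : A ≤ k := hn.trans ((Nat.le_ceil _).trans
    (by exact_mod_cast (Finset.mem_Icc.1 (hG hk)).1))
  have := hbad k hk
  simp only [hEdef, mem_ofPred_eq, hAk, true_and, not_lt] at this
  rw [Real.rpow_add (r0 n)]
  exact this

end IsFractionalBrownianMotion

/-! ### Bounds for the scale spectrum -/

/-- The detail coefficient, in the coordinate `u = 2 ^ (-j) t - k` of the analyzing function. -/
lemma detailCoeff_eq (ψ Z : ℝ → ℝ) (j k : ℤ) :
    detailCoeff ψ Z j k =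
      ((2 : ℝ) ^ j) ^ (1 / 2 : ℝ) * ∫ u, ψ u * Z ((2 : ℝ) ^ j * k + (2 : ℝ) ^ j * u) := by
  set r : ℝ := (2 : ℝ) ^ j with hr
  have r0 : 0 < r := by positivity
  set f : ℝ → ℝ := fun u => ψ u * Z (r * k + r * u) with hf
  have h1 : ∀ t : ℝ, ψ ((2 : ℝ) ^ (-j) * t - k) * Z t = f (r⁻¹ * t - k) := by
    intro t
    simp only [hf]
    rw [zpow_neg, show r * (k : ℝ) + r * (r⁻¹ * t - k) = r * r⁻¹ * t by ring,
      mul_inv_cancel₀ r0.ne', one_mul]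
  have h2 := Measure.integral_comp_mul_left (fun y => f (y - k)) r⁻¹
  rw [integral_sub_right_eq_self, inv_inv, abs_of_pos r0, smul_eq_mul] at h2
  rw [detailCoeff]
  simp_rw [h1]
  rw [h2, ← mul_assoc]
  congr 1
  have h3 : (2 : ℝ) ^ (-(j : ℝ) / 2) = r ^ (-(1 / 2) : ℝ) := by
    rw [hr, ← Real.rpow_intCast, ← Real.rpow_mul (by norm_num)]
    congr 1; ring
  rw [h3]
  nth_rewrite 2 [← Real.rpow_one r]
  rw [← Real.rpow_add r0]
  norm_num

lemma detailCoeff_sq (ψ Z : ℝ → ℝ) (j k : ℤ) :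
    detailCoeff ψ Z j k ^ 2 =
      (2 : ℝ) ^ j * (∫ u, ψ u * Z ((2 : ℝ) ^ j * k + (2 : ℝ) ^ j * u)) ^ 2 := by
  rw [detailCoeff_eq, mul_pow, ← Real.rpow_natCast (((2 : ℝ) ^ j) ^ (1 / 2 : ℝ)),
    ← Real.rpow_mul (by positivity)]
  norm_num

lemma scaleSpectrum_eq_zero {ψ Z : ℝ → ℝ} {N : ℕ} {j : ℤ} (h : (N : ℝ) < 2 ^ j) :
    scaleSpectrum ψ Z N j = 0 := by
  have : ⌊(N : ℝ) / (2 : ℝ) ^ j⌋₊ = 0 := by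
    rw [Nat.floor_eq_zero, div_lt_one (by positivity)]; exact h
  rw [scaleSpectrum, this]
  simp

lemma scaleSpectrum_le_of_forall {ψ Z : ℝ → ℝ} {N : ℕ} (hN : 1 ≤ N) {j : ℤ} {D : ℝ}
    (h : ∀ k : ℤ, |∫ u, ψ u * Z ((2 : ℝ) ^ j * k + (2 : ℝ) ^ j * u)| ≤ D) :
    scaleSpectrum ψ Z N j ≤ (2 : ℝ) ^ j * D ^ 2 := by
  have r0 : (0 : ℝ) < 2 ^ j := by positivity
  have hN0 : (0 : ℝ) < N := by exact_mod_cast hN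
  have h1 : ∑ k ∈ Finset.Icc 1 ⌊(N : ℝ) / (2 : ℝ) ^ j⌋₊, detailCoeff ψ Z j (k : ℤ) ^ 2 ≤
      (N : ℝ) / (2 : ℝ) ^ j * ((2 : ℝ) ^ j * D ^ 2) := by
    refine (Finset.sum_le_card_nsmul _ _ ((2 : ℝ) ^ j * D ^ 2) fun k _ => ?_).trans ?_
    · rw [detailCoeff_sq]
      refine mul_le_mul_of_nonneg_left ?_ r0.le
      exact sq_le_sq' (neg_le_of_abs_le (h k)) ((le_abs_self _).trans (h k))
    · rw [nsmul_eq_mul, Nat.card_Icc, Nat.add_sub_cancel]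
      gcongr
      exact Nat.floor_le (by positivity)
  rw [scaleSpectrum]
  calc _ ≤ 1 / ((N : ℝ) / 2 ^ j) * ((N : ℝ) / (2 : ℝ) ^ j * ((2 : ℝ) ^ j * D ^ 2)) := by gcongr
    _ = _ := by field_simp

lemma integrable_mul_of_continuous {g b : ℝ → ℝ} {A : ℝ} (hg : Integrable g)
    (hgA : ∀ u, A ≤ |u| → g u = 0) (hb : Continuous b) : Integrable fun u => g u * b u := by
  refine (integrableOn_iff_integrable_of_support_subset (s := Icc (-A) A) fun u hu => ?_).1
    (hg.integrableOn.mul_continuousOn hb.continuousOn isCompact_Icc)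
  by_contra hc
  refine hu ?_
  simp only
  rw [hgA u, zero_mul]
  by_contra hlt
  push Not at hlt
  exact hc (abs_le.1 hlt.le)

/-- For `∫ g = 0` the integrals of `b₁` and `s b₂` against `g` differ little if the increments of
`b₁` and `s b₂` from a reference point do. -/
lemma abs_integral_mul_sub_le {g b₁ b₂ : ℝ → ℝ} {A s c₁ c₂ ε : ℝ} (hg : Integrable g)
    (hgA : ∀ u, A ≤ |u| → g u = 0) (h0 : ∫ x, g x = 0) (hb₁ : Continuous b₁) (hb₂ : Continuous b₂)
    (h : ∀ u, |u| ≤ A → |b₁ u - c₁ - s * (b₂ u - c₂)| ≤ ε) :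
    |(∫ u, g u * b₁ u) - s * ∫ u, g u * b₂ u| ≤ ε * ∫ u, |g u| := by
  have i1 := integrable_mul_of_continuous hg hgA hb₁
  have i2 := integrable_mul_of_continuous hg hgA hb₂
  have e : (∫ u, g u * b₁ u) - s * ∫ u, g u * b₂ u =
      ∫ u, g u * (b₁ u - c₁ - s * (b₂ u - c₂)) := by
    have e' : ∀ u, g u * (b₁ u - c₁ - s * (b₂ u - c₂)) =
        g u * b₁ u - s * (g u * b₂ u) - g u * (c₁ - s * c₂) := by intro u; ring
    simp_rw [e']
    rw [integral_sub (f := fun u => g u * b₁ u - s * (g u * b₂ u)) (i1.sub (i2.const_mul s))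
      (hg.mul_const _), integral_sub i1 (i2.const_mul s), integral_const_mul,
      integral_mul_const, h0, zero_mul, sub_zero]
  rw [e, ← Real.norm_eq_abs, ← integral_const_mul]
  refine norm_integral_le_of_norm_le (hg.abs.const_mul ε) (Eventually.of_forall fun u => ?_)
  rw [norm_mul, Real.norm_eq_abs, Real.norm_eq_abs]
  rcases le_total |u| A with hu | hu
  · rw [mul_comm]
    exact mul_le_mul_of_nonneg_right (h u hu) (abs_nonneg _)
  · simp [hgA u hu]

/-- **Upper bound**: the scale spectrum of a Hölder continuous function. -/
theorem scaleSpectrum_le_of_holder {ψ Z : ℝ → ℝ} {A K γ : ℝ} (hψ : Integrable ψ)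
    (hψA : ∀ u, A ≤ |u| → ψ u = 0) (h0 : ∫ x, ψ x = 0) (hA : 0 ≤ A) (hγ : 0 ≤ γ) (hK : 0 ≤ K)
    (hZc : Continuous Z) (hZ : ∀ s t, |Z t - Z s| ≤ K * |t - s| ^ γ) {N : ℕ} (hN : 1 ≤ N) (j : ℤ) :
    scaleSpectrum ψ Z N j ≤
      (K * A ^ γ * ∫ u, |ψ u|) ^ 2 * (2 : ℝ) ^ ((j : ℝ) * (2 * γ + 1)) := by
  set r : ℝ := (2 : ℝ) ^ j with hr
  have r0 : 0 < r := by positivity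
  refine (scaleSpectrum_le_of_forall hN (D := K * (r * A) ^ γ * ∫ u, |ψ u|) fun k => ?_).trans
    (le_of_eq ?_)
  · have := abs_integral_mul_sub_le (b₁ := fun u => Z (r * k + r * u)) (b₂ := fun _ => 0)
      (s := 0) (c₁ := Z (r * k)) (c₂ := 0) (ε := K * (r * A) ^ γ) hψ hψA h0
      (hZc.comp (by fun_prop)) continuous_const (fun u hu => by
        rw [zero_mul, sub_zero]
        refine (hZ _ _).trans ?_
        rw [add_sub_cancel_left, abs_mul, abs_of_pos r0]
        gcongr)
    rwa [zero_mul, sub_zero] at this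
  · rw [Real.rpow_mul (by norm_num), Real.rpow_intCast, ← hr, Real.mul_rpow r0.le hA,
      Real.rpow_add r0, Real.rpow_one, mul_comm 2 γ, Real.rpow_mul r0.le]
    norm_cast
    ring

lemma zpow_neg_natCast_eq (n : ℕ) : (2 : ℝ) ^ (-(n : ℤ)) = (1 / 2 : ℝ) ^ n := by
  rw [zpow_neg, zpow_natCast, one_div, inv_pow]

lemma eventually_atBot_int_of_nat {p : ℤ → Prop} (h : ∀ᶠ n : ℕ in atTop, p (-(n : ℤ))) :
    ∀ᶠ j : ℤ in atBot, p j := by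
  obtain ⟨M, hM⟩ := eventually_atTop.1 h
  filter_upwards [eventually_le_atBot (-(M : ℤ))] with j hj
  have := hM (-j).toNat (by omega)
  rwa [Int.toNat_of_nonneg (by omega), neg_neg] at this

lemma clamp_mem {T : ℝ} (hT : 0 ≤ T) (t : ℝ) : min (max t 0) T ∈ Icc 0 T :=
  ⟨le_min (le_max_right _ _) hT, min_le_right _ _⟩

lemma clamp_of_mem {T t : ℝ} (ht : t ∈ Icc 0 T) : min (max t 0) T = t := by
  rw [max_eq_left ht.1, min_eq_left ht.2]

/-- **Lower bound**: if `F` is a sewing of `f dg`, `|f| ≥ m` on `[a, b]`, and at least half of the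
coefficients of `g` located there are of order at least `H'`, then so are those of `F`, because
`f (g_t - g_s)` dominates the error of order `θ > H'`. -/
theorem exists_le_scaleSpectrum {ψ f g F : ℝ → ℝ} {A C θ T H' a b m : ℝ} {N : ℕ} (hψ : Integrable ψ)
    (hψA : ∀ u, A ≤ |u| → ψ u = 0) (h0 : ∫ x, ψ x = 0) (hA : 0 ≤ A) (hN : 1 ≤ N)
    (hH' : H' < θ) (hF : IsSewing C θ T f g F) (hθ : 0 < θ)
    (hFc : ContinuousOn F (Icc 0 T)) (hg : Continuous g)
    (ha : 0 < a) (hab : a < b) (hbT : b < T) (hbN : b ≤ N) (hm : 0 < m)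
    (hf : ∀ x ∈ Icc a b, m ≤ |f x|)
    (hlarge : ∀ᶠ n : ℕ in atTop, ∃ G ⊆ Finset.Icc ⌈a * 2 ^ n⌉₊ ⌊b * 2 ^ n⌋₊,
      (Finset.Icc ⌈a * 2 ^ n⌉₊ ⌊b * 2 ^ n⌋₊).card ≤ 2 * G.card ∧ ∀ k ∈ G,
        ((1 / 2 : ℝ) ^ n) ^ H' ≤
          |∫ u, ψ u * g ((1 / 2 : ℝ) ^ n * k + (1 / 2 : ℝ) ^ n * u)|) :
    ∃ c > 0, ∀ᶠ j : ℤ in atBot, c * (2 : ℝ) ^ ((j : ℝ) * (2 * H' + 1)) ≤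
      scaleSpectrum ψ (fun t => F (min (max t 0) T)) N j := by
  have hT : 0 ≤ T := by linarith
  have hN0 : (0 : ℝ) < N := by exact_mod_cast hN
  set Z : ℝ → ℝ := fun t => F (min (max t 0) T) with hZ
  have hZc : Continuous Z := hFc.comp_continuous (by fun_prop) (clamp_mem hT)
  set L := ∫ u, |ψ u| with hL
  have hL0 : 0 ≤ L := integral_nonneg fun _ => abs_nonneg _
  have hC := hF.1
  set r : ℕ → ℝ := fun n => (1 / 2 : ℝ) ^ n with hr
  have r0 : ∀ n, 0 < r n := fun n => by positivity
  have rinv : ∀ n, r n * 2 ^ n = 1 := fun n => by simp only [hr]; rw [← mul_pow]; norm_num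
  have hrlim : Tendsto r atTop (nhds 0) :=
    tendsto_pow_atTop_nhds_zero_of_lt_one (by norm_num) (by norm_num)
  have hsmall : ∀ᶠ n in atTop, r n * A < min 1 (min a (T - b)) := by
    have h1 : Tendsto (fun n => r n * A) atTop (nhds 0) := by simpa using hrlim.mul_const A
    exact h1.eventually (gt_mem_nhds (lt_min one_pos (lt_min ha (by linarith))))
  -- the error term is of higher order than the large coefficients of `g`
  have herr : ∀ᶠ n in atTop, C * A ^ θ * L * r n ^ (θ - H') < m / 2 := by
    have h1 : Tendsto (fun n => r n ^ (θ - H')) atTop (nhds 0) := by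
      have := (Real.continuousAt_rpow_const 0 (θ - H') (Or.inr (by linarith))).tendsto.comp hrlim
      rwa [Real.zero_rpow (by linarith)] at this
    have h2 := h1.const_mul (C * A ^ θ * L)
    rw [mul_zero] at h2
    exact h2.eventually (gt_mem_nhds (by positivity))
  have hcard : ∀ᶠ n in atTop, r n < (b - a) / 2 :=
    hrlim.eventually (gt_mem_nhds (by linarith))
  refine ⟨(b - a) / (4 * N) * (m / 2) ^ 2, by
    have : 0 < b - a := by linarith
    positivity, eventually_atBot_int_of_nat ?_⟩
  filter_upwards [hlarge, hsmall, herr, hcard] with n ⟨G, hG, hGc, hGl⟩ h1 h2 h3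
  change ∀ k ∈ G, r n ^ H' ≤ |∫ u, ψ u * g (r n * k + r n * u)| at hGl
  have hrn := r0 n
  have hrA1 : r n * A ≤ 1 := (h1.trans_le (min_le_left _ _)).le
  have hrAa : r n * A ≤ a := (h1.trans_le ((min_le_right _ _).trans (min_le_left _ _))).le
  have hrAT : r n * A ≤ T - b := (h1.trans_le ((min_le_right _ _).trans (min_le_right _ _))).le
  have key : ∀ k ∈ G, m / 2 * r n ^ H' ≤ |∫ u, ψ u * Z (r n * k + r n * u)| := by
    intro k hk
    obtain ⟨k1, k2⟩ := Finset.mem_Icc.1 (hG hk)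
    have hx : r n * k ∈ Icc a b := by
      have e1 : a * 2 ^ n ≤ k := (Nat.le_ceil _).trans (by exact_mod_cast k1)
      have e2 : (k : ℝ) ≤ b * 2 ^ n :=
        (Nat.cast_le.2 k2).trans (Nat.floor_le (by have := ha.trans hab; positivity))
      constructor
      · calc a = r n * (a * 2 ^ n) := by rw [mul_left_comm, rinv, mul_one]
          _ ≤ _ := by gcongr
      · calc r n * k ≤ r n * (b * 2 ^ n) := by gcongr
          _ = b := by rw [mul_left_comm, rinv, mul_one]
    set x := r n * k
    have hxT : x ∈ Icc 0 T := ⟨by linarith [hx.1], by linarith [hx.2]⟩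
    have diff := abs_integral_mul_sub_le (b₁ := fun u => Z (x + r n * u))
      (b₂ := fun u => g (x + r n * u)) (s := f x) (c₁ := Z x) (c₂ := g x)
      (ε := C * (r n * A) ^ θ) hψ hψA h0 (hZc.comp (by fun_prop)) (hg.comp (by fun_prop))
      (fun u hu => by
        have hu' : |r n * u| ≤ r n * A := by rw [abs_mul, abs_of_pos hrn]; gcongr
        obtain ⟨u1, u2⟩ := abs_le.1 hu'
        have hyT : x + r n * u ∈ Icc 0 T := ⟨by linarith [hx.1], by linarith [hx.2]⟩
        simp only [hZ]
        rw [clamp_of_mem hxT, clamp_of_mem hyT]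
        refine (hF.2.2 x hxT _ hyT (by rw [add_sub_cancel_left]; linarith)).trans ?_
        rw [add_sub_cancel_left]
        gcongr)
    have e : C * (r n * A) ^ θ * L = (C * A ^ θ * L * r n ^ (θ - H')) * r n ^ H' := by
      rw [Real.mul_rpow hrn.le hA, mul_assoc _ (r n ^ (θ - H')), ← Real.rpow_add hrn,
        sub_add_cancel]
      ring
    have hrH : 0 < r n ^ H' := Real.rpow_pos_of_pos hrn _
    have herr' : C * (r n * A) ^ θ * L ≤ m / 2 * r n ^ H' := by
      rw [e]; gcongr
    have hmain : m * r n ^ H' ≤ |f x * ∫ u, ψ u * g (x + r n * u)| := by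
      rw [abs_mul]
      exact mul_le_mul (hf x hx) (hGl k hk) hrH.le (abs_nonneg _)
    have tri := abs_sub_abs_le_abs_sub (f x * ∫ u, ψ u * g (x + r n * u))
      (∫ u, ψ u * Z (x + r n * u))
    rw [abs_sub_comm] at tri
    linarith
  have hGcard : (b - a) / 4 ≤ r n * G.card := by
    have c1 : b * 2 ^ n - a * 2 ^ n - 1 ≤ (Finset.Icc ⌈a * 2 ^ n⌉₊ ⌊b * 2 ^ n⌋₊).card := by
      rw [Nat.card_Icc]
      have f1 := Nat.lt_floor_add_one (b * 2 ^ n)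
      have f2 := Nat.ceil_lt_add_one (a := a * 2 ^ n) (by positivity)
      have f3 : ((⌊b * 2 ^ n⌋₊ : ℝ) + 1) - ⌈a * 2 ^ n⌉₊ ≤
          ((⌊b * 2 ^ n⌋₊ + 1 - ⌈a * 2 ^ n⌉₊ : ℕ) : ℝ) := by
        rw [sub_le_iff_le_add]
        exact_mod_cast (by omega : ⌊b * 2 ^ n⌋₊ + 1 ≤
          ⌊b * 2 ^ n⌋₊ + 1 - ⌈a * 2 ^ n⌉₊ + ⌈a * 2 ^ n⌉₊)
      linarith
    have c2 : ((Finset.Icc ⌈a * 2 ^ n⌉₊ ⌊b * 2 ^ n⌋₊).card : ℝ) ≤ 2 * G.card := by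
      exact_mod_cast hGc
    have c3 := mul_le_mul_of_nonneg_left (c1.trans c2) hrn.le
    have c4 : r n * (b * 2 ^ n - a * 2 ^ n - 1) = (b - a) * (r n * 2 ^ n) - r n := by ring
    rw [c4, rinv] at c3
    linarith
  have e2 : (2 : ℝ) ^ (-(n : ℤ)) = r n := zpow_neg_natCast_eq n
  have hsub : G ⊆ Finset.Icc 1 ⌊(N : ℝ) / r n⌋₊ := by
    intro k hk
    obtain ⟨k1, k2⟩ := Finset.mem_Icc.1 (hG hk)
    refine Finset.mem_Icc.2 ⟨(Nat.one_le_ceil_iff.2 (by positivity)).trans k1,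
      k2.trans (Nat.floor_le_floor ?_)⟩
    rw [le_div_iff₀ hrn, mul_assoc, mul_comm _ (r n), rinv, mul_one]
    exact hbN
  rw [scaleSpectrum, e2]
  have hsum : (G.card : ℝ) * (r n * (m / 2 * r n ^ H') ^ 2) ≤
      ∑ k ∈ Finset.Icc 1 ⌊(N : ℝ) / r n⌋₊, detailCoeff ψ Z (-(n : ℤ)) (k : ℤ) ^ 2 := by
    calc _ ≤ ∑ k ∈ G, detailCoeff ψ Z (-(n : ℤ)) (k : ℤ) ^ 2 := by
          rw [← nsmul_eq_mul]
          refine Finset.card_nsmul_le_sum _ _ _ fun k hk => ?_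
          rw [detailCoeff_sq, e2]
          refine mul_le_mul_of_nonneg_left ?_ hrn.le
          rw [← sq_abs (∫ u, _)]
          have := key k hk
          have hrH : 0 < r n ^ H' := Real.rpow_pos_of_pos hrn _
          rw [Int.cast_natCast]
          gcongr
      _ ≤ _ := Finset.sum_le_sum_of_subset_of_nonneg hsub fun _ _ _ => sq_nonneg _
  have e3 : (2 : ℝ) ^ (((-(n : ℤ) : ℤ) : ℝ) * (2 * H' + 1)) = r n ^ H' * r n ^ H' * r n := by
    rw [Real.rpow_mul (by norm_num), Real.rpow_intCast, e2, Real.rpow_add hrn, Real.rpow_one,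
      two_mul, Real.rpow_add hrn]
  rw [e3]
  have hrH : 0 < r n ^ H' := Real.rpow_pos_of_pos hrn _
  calc (b - a) / (4 * N) * (m / 2) ^ 2 * (r n ^ H' * r n ^ H' * r n)
      = 1 / (N / r n) * ((b - a) / 4 / r n * (r n * (m / 2 * r n ^ H') ^ 2)) := by
        field_simp
    _ ≤ 1 / (N / r n) * (G.card * (r n * (m / 2 * r n ^ H') ^ 2)) := by
        gcongr
        rw [div_le_iff₀ hrn, mul_comm]
        exact hGcard
    _ ≤ _ := by gcongr

/-! ### Scaling exponents -/

lemma tendsto_intCast_atBot : Tendsto (fun j : ℤ => (j : ℝ)) atBot atBot :=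
  tendsto_intCast_atBot_iff.2 tendsto_id

lemma eventually_mul_rpow_lt {γ γ' c c' : ℝ} (hγ : γ' < γ) (hc' : 0 < c') :
    ∀ᶠ j : ℤ in atBot, c * (2 : ℝ) ^ ((j : ℝ) * (2 * γ + 1)) <
      c' * (2 : ℝ) ^ ((j : ℝ) * (2 * γ' + 1)) := by
  have h1 : Tendsto (fun j : ℤ => (2 : ℝ) ^ ((j : ℝ) * (2 * (γ - γ')))) atBot (nhds 0) := by
    have h2 : Tendsto (fun j : ℤ => (j : ℝ) * (2 * (γ - γ'))) atBot atBot :=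
      tendsto_intCast_atBot.atBot_mul_const (by linarith)
    exact (tendsto_rpow_atBot_of_base_gt_one 2 one_lt_two).comp h2
  have h3 := h1.const_mul c
  rw [mul_zero] at h3
  filter_upwards [h3.eventually (gt_mem_nhds hc')] with j hj
  have e : (j : ℝ) * (2 * γ + 1) = (j : ℝ) * (2 * (γ - γ')) + (j : ℝ) * (2 * γ' + 1) := by ring
  rw [e, Real.rpow_add (by norm_num), ← mul_assoc]
  gcongr

/-- Upper bounds of every order below `H` and lower bounds of every order above `H` determine the
exponent. -/
theorem scaling_of_bounds {S : ℤ → ℝ} {H : ℝ}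
    (hup : ∀ γ < H, ∃ c > 0, ∀ j : ℤ, S j ≤ c * (2 : ℝ) ^ ((j : ℝ) * (2 * γ + 1)))
    (hlow : ∀ γ > H, ∃ c > 0, ∀ᶠ j : ℤ in atBot, c * (2 : ℝ) ^ ((j : ℝ) * (2 * γ + 1)) ≤ S j) :
    (∀ γ > H, ∀ c : ℝ, {j : ℤ | j < 0 ∧ ¬ S j ≤ c * (2 : ℝ) ^ ((j : ℝ) * (2 * γ + 1))}.Infinite) ∧
      (∀ᶠ j : ℤ in atBot, 0 < S j) ∧
      liminf (fun j : ℤ => ((Real.logb 2 (S j) / (j : ℝ) : ℝ) : EReal)) atBot =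
        ((2 * H + 1 : ℝ) : EReal) := by
  have hpos : ∀ᶠ j : ℤ in atBot, 0 < S j := by
    obtain ⟨c, hc, h⟩ := hlow (H + 1) (by linarith)
    filter_upwards [h] with j hj
    exact (by positivity : 0 < c * (2 : ℝ) ^ ((j : ℝ) * (2 * (H + 1) + 1))).trans_le hj
  have hneg : ∀ᶠ j : ℤ in atBot, j < 0 := eventually_lt_atBot 0
  have hconst : ∀ x : ℝ, Tendsto (fun j : ℤ => x / (j : ℝ)) atBot (nhds 0) := fun x =>
    tendsto_const_nhds.div_atBot tendsto_intCast_atBot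
  have hlog : ∀ {c γ : ℝ} (j : ℤ), 0 < c → Real.logb 2 (c * (2 : ℝ) ^ ((j : ℝ) * (2 * γ + 1))) =
      Real.logb 2 c + (j : ℝ) * (2 * γ + 1) := by
    intro c γ j hc
    rw [Real.logb_mul hc.ne' (by positivity), Real.logb_rpow (by norm_num) (by norm_num)]
  refine ⟨fun γ hγ c => ?_, hpos, ?_⟩
  · obtain ⟨c', hc', h⟩ := hlow ((H + γ) / 2) (by linarith)
    obtain ⟨M, hM⟩ := eventually_atBot.1
      ((h.and (eventually_mul_rpow_lt (c := c) (by linarith : (H + γ) / 2 < γ) hc')).and hneg)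
    refine (Set.Iic_infinite M).mono fun j hj => ?_
    obtain ⟨⟨a1, a2⟩, a3⟩ := hM j hj
    exact ⟨a3, not_le.2 (a2.trans_le a1)⟩
  · have hlim : Tendsto (fun j : ℤ => Real.logb 2 (S j) / (j : ℝ)) atBot (nhds (2 * H + 1)) := by
      rw [tendsto_order]
      constructor
      · intro x hx
        obtain ⟨c, hc, h⟩ := hup ((x - 1) / 4 + H / 2) (by linarith)
        filter_upwards [hpos, hneg, (hconst (Real.logb 2 c)).eventually
          (lt_mem_nhds (by linarith : x / 2 - H - 1 / 2 < 0))] with j h1 h2 h3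
        have hj : (j : ℝ) < 0 := by exact_mod_cast h2
        have h4 := Real.logb_le_logb_of_le (b := 2) (by norm_num) h1 (h j)
        rw [hlog j hc] at h4
        rw [lt_div_iff_of_neg hj] at h3 ⊢
        nlinarith
      · intro x hx
        obtain ⟨c, hc, h⟩ := hlow ((x - 1) / 4 + H / 2) (by linarith)
        filter_upwards [h, hneg, (hconst (Real.logb 2 c)).eventually
          (gt_mem_nhds (by linarith : 0 < x / 2 - H - 1 / 2))] with j h1 h2 h3
        have hj : (j : ℝ) < 0 := by exact_mod_cast h2
        have h4 := Real.logb_le_logb_of_le (b := 2) (by norm_num) (by positivity) h1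
        rw [hlog j hc] at h4
        rw [div_lt_iff_of_neg hj] at h3 ⊢
        nlinarith
    exact ((continuous_coe_real_ereal.tendsto _).comp hlim).liminf_eq

/-! ### Measurability of the Hölder constant -/

/-- The Hölder constant of order `γ` of a function, tested on rational arguments only, so that it is
a countable supremum. -/
noncomputable def ratHolderConst (γ : ℝ) (Z : ℝ → ℝ) : ENNReal :=
  ⨆ q : ℚ × ℚ, ‖(Z q.2 - Z q.1) / |(q.2 : ℝ) - q.1| ^ γ‖ₑ

lemma ratHolderConst_lt_top {γ K : ℝ} (hK : 0 ≤ K) {Z : ℝ → ℝ}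
    (h : ∀ s t, |Z t - Z s| ≤ K * |t - s| ^ γ) : ratHolderConst γ Z < ⊤ := by
  refine (iSup_le fun q => ?_ : ratHolderConst γ Z ≤ ENNReal.ofReal K).trans_lt
    ENNReal.ofReal_lt_top
  rw [← ofReal_norm]
  refine ENNReal.ofReal_le_ofReal ?_
  rw [norm_div, Real.norm_eq_abs, Real.norm_of_nonneg (Real.rpow_nonneg (abs_nonneg _) _)]
  exact div_le_of_le_mul₀ (Real.rpow_nonneg (abs_nonneg _) _) hK (h _ _)

lemma abs_sub_le_ratHolderConst {γ : ℝ} (hγ : 0 ≤ γ) {Z : ℝ → ℝ} (hZ : Continuous Z)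
    (h : ratHolderConst γ Z < ⊤) (s t : ℝ) :
    |Z t - Z s| ≤ (ratHolderConst γ Z).toReal * |t - s| ^ γ := by
  refine DenseRange.induction_on₂ (e := ((↑) : ℚ → ℝ)) Rat.denseRange_cast ?_ (fun p q => ?_) s t
  · refine isClosed_le (by fun_prop) (continuous_const.mul (Continuous.rpow_const (by fun_prop)
      fun _ => Or.inr hγ))
  · rcases eq_or_ne (q : ℝ) p with hpq | hpq
    · rw [hpq, sub_self, abs_zero]
      exact mul_nonneg ENNReal.toReal_nonneg (Real.rpow_nonneg (abs_nonneg _) _)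
    have hpos : 0 < |(q : ℝ) - p| ^ γ := Real.rpow_pos_of_pos (abs_pos.2 (sub_ne_zero.2 hpq)) _
    have h1 : ‖(Z q - Z p) / |(q : ℝ) - p| ^ γ‖ₑ ≤ ratHolderConst γ Z :=
      le_iSup (fun q : ℚ × ℚ => ‖(Z q.2 - Z q.1) / |(q.2 : ℝ) - q.1| ^ γ‖ₑ) (p, q)
    have h2 := ENNReal.toReal_mono h.ne h1
    rwa [toReal_enorm, norm_div, Real.norm_eq_abs, Real.norm_of_nonneg hpos.le,
      div_le_iff₀ hpos] at h2

lemma HolderOnInterval.clamp {C γ T : ℝ} {F : ℝ → ℝ} (hγ : 0 ≤ γ) (hT : 0 ≤ T)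
    (h : HolderOnInterval C γ T F) (s t : ℝ) :
    |F (min (max t 0) T) - F (min (max s 0) T)| ≤ C * |t - s| ^ γ := by
  refine (h.2 _ (clamp_mem hT s) _ (clamp_mem hT t)).trans
    (mul_le_mul_of_nonneg_left (Real.rpow_le_rpow (abs_nonneg _) ?_ hγ) h.1)
  calc _ ≤ max |max t 0 - max s 0| |T - T| := abs_min_sub_min_le_max _ _ _ _
    _ ≤ |t - s| := by
      rw [sub_self, abs_zero]
      refine max_le ((abs_max_sub_max_le_max _ _ _ _).trans ?_) (abs_nonneg _)
      rw [sub_self, abs_zero]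
      exact max_le le_rfl (abs_nonneg _)

/-! ### The paths of the integral -/

/-- The properties of almost every pair of paths `f` of `σ` and `g` of `B` from which the bounds
are deduced: the integral `F` of `f dg` exists on `[0, T]`, is a sewing of order greater than `1`,
and is Hölder continuous of the orders `γ n`. -/
structure IsGoodPath (T : ℝ) (γ : ℕ → ℝ) (f g F : ℝ → ℝ) : Prop where
  continuousOn : ContinuousOn f (Icc 0 T)
  continuous : Continuous g
  isIntegral : ∀ x ∈ Icc (0 : ℝ) T, IsRiemannStieltjesIntegral f g 0 x (F x)
  sewing : ∃ C θ, 1 < θ ∧ IsSewing C θ T f g F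
  holder : ∀ n, ∃ K, HolderOnInterval K (γ n) T F

lemma IsGoodPath.pathwiseIntegral_eq {Ω : Type*} {B : ℝ≥0 → Ω → ℝ} {σ : ℝ → Ω → ℝ} {T : ℝ}
    {γ : ℕ → ℝ} {ω : Ω} {F : ℝ → ℝ} (hT : 0 ≤ T)
    (h : IsGoodPath T γ (fun t => σ t ω) (fun t => B t.toNNReal ω) F) (t : ℝ) :
    pathwiseIntegral σ B T t ω = F (min (max t 0) T) :=
  riemannStieltjesIntegral_eq (clamp_mem hT t).1 (h.isIntegral _ (clamp_mem hT t))

lemma exists_Ioo_seq {H : ℝ} (hH : 0 < H) :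
    ∃ γ : ℕ → ℝ, (∀ n, 0 < γ n ∧ γ n < H) ∧ ∀ x < H, ∃ n, x < γ n := by
  obtain ⟨γ, -, h1, h2⟩ := exists_seq_strictMono_tendsto' hH
  exact ⟨γ, h1, fun x hx => (h2.eventually (lt_mem_nhds hx)).exists⟩

section

variable {Ω : Type*} [MeasurableSpace Ω] {P : Measure Ω} {H T : ℝ} {B : ℝ≥0 → Ω → ℝ}
  {σ : ℝ → Ω → ℝ}

theorem ae_exists_isGoodPath [IsProbabilityMeasure P] (hB : IsFractionalBrownianMotion H B P)
    (hH : H ∈ Ioo (0 : ℝ) 1) (hT : 0 < T)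
    (hσ : ∀ᵐ ω ∂P, ∃ α K : ℝ≥0, 1 - H < (α : ℝ) ∧
      HolderOnWith K α (fun t => σ t ω) (Icc (0 : ℝ) T))
    {γ : ℕ → ℝ} (hγ : ∀ n, 0 < γ n ∧ γ n < H) (hγH : ∀ x < H, ∃ n, x < γ n) :
    ∀ᵐ ω ∂P, ∃ F, IsGoodPath T γ (fun t => σ t ω) (fun t => B t.toNNReal ω) F := by
  filter_upwards [hσ, hB.ae_continuous, ae_all_iff.2 fun n =>
    hB.ae_exists_holderOnInterval (hγ n).1 (hγ n).2 T] with ω ⟨α, K, hα, hK⟩ hc hω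
  have hH1 : 0 < 1 - H := by linarith [hH.2]
  have hα0 : (0 : ℝ) < α := by linarith
  obtain ⟨n, hn⟩ := hγH (1 - α) (by linarith)
  obtain ⟨K', hf⟩ := hK.holderOnInterval hα0.le le_rfl
  obtain ⟨L, hg⟩ := hω n
  have hsum : 1 < α + γ n := by linarith
  obtain ⟨F, C, hF⟩ := exists_isSewing hT.le hα0.le (hγ n).1.le hsum hf hg
  exact ⟨F, hf.continuousOn hα0, hc, fun x hx =>
    hF.isRiemannStieltjesIntegral hα0.le (hγ n).1.le hsum hf hg hx, ⟨C, _, hsum, hF⟩, fun m => by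
      obtain ⟨L', hg'⟩ := hω m
      exact hF.exists_holderOnInterval (hγ m).1.le (by linarith [(hγ m).2, hH.2])
        (hf.continuousOn hα0) hg'⟩

/-- The integral at a fixed time is an almost sure limit of Riemann sums, hence measurable. -/
lemma aemeasurable_pathwiseIntegral (hB : ∀ t, AEMeasurable (B t) P) (hT : 0 ≤ T)
    (hσm : ∀ t ∈ Icc (0 : ℝ) T, AEMeasurable (σ t) P) {γ : ℕ → ℝ}
    (h : ∀ᵐ ω ∂P, ∃ F, IsGoodPath T γ (fun t => σ t ω) (fun t => B t.toNNReal ω) F) (t : ℝ) :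
    AEMeasurable (pathwiseIntegral σ B T t) P := by
  set x := min (max t 0) T
  have hx : x ∈ Icc 0 T := clamp_mem hT t
  refine aemeasurable_of_tendsto_metrizable_ae' (f := fun n ω => ∑ i ∈ Finset.range (n + 1),
    σ (i * (x / (n + 1))) ω * (B (((i + 1 : ℕ) * (x / (n + 1)) : ℝ)).toNNReal ω -
      B ((i * (x / (n + 1)) : ℝ)).toNNReal ω)) (fun n => ?_) ?_
  · refine Finset.aemeasurable_fun_sum _ fun i hi => (hσm _ ?_).mul ((hB _).sub (hB _))
    have hi' : (i : ℝ) ≤ n + 1 := by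
      exact_mod_cast (Finset.mem_range.1 hi).le
    have := hx.1
    refine ⟨by positivity, le_trans ?_ hx.2⟩
    rw [mul_div_assoc', div_le_iff₀ (by positivity), mul_comm x]
    gcongr
  · filter_upwards [h] with ω ⟨F, hF⟩
    rw [hF.pathwiseIntegral_eq hT]
    exact (hF.isIntegral x hx).tendsto_equal_cells hx.1

end

/-- If `f` does not vanish identically on `[0, min T M]`, it is bounded away from zero on an
interval with rational end points inside. For the path of `σ` this interval is random, but there
are only countably many candidates, so it can be chosen after the exceptional null sets. -/
lemma exists_rat_Icc_of_ne_zero {f : ℝ → ℝ} {T M : ℝ} (hT : 0 < T) (hM : 0 < M)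
    (hf : ContinuousOn f (Icc 0 T)) (h : ∃ t ∈ Icc (0 : ℝ) (min T M), f t ≠ 0) :
    ∃ a b : ℚ, (0 : ℝ) < a ∧ (a : ℝ) < b ∧ (b : ℝ) < T ∧ (b : ℝ) < M ∧
      ∃ m > 0, ∀ x ∈ Icc (a : ℝ) b, m ≤ |f x| := by
  obtain ⟨t, ht, hne⟩ := h
  have hTM : 0 < min T M := lt_min hT hM
  have hpos : 0 < |f t| / 2 := by have := abs_pos.2 hne; positivity
  have hcont : ContinuousWithinAt (fun x => |f x|) (Ioo 0 (min T M)) t :=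
    ((hf.abs) t ⟨ht.1, ht.2.trans (min_le_left _ _)⟩).mono
      fun x hx => ⟨hx.1.le, (hx.2.trans_le (min_le_left _ _)).le⟩
  have hmem : t ∈ closure (Ioo 0 (min T M)) := by rwa [closure_Ioo hTM.ne]
  have hev := hcont.eventually (lt_mem_nhds (half_lt_self (abs_pos.2 hne)))
  obtain ⟨U, hU, hUt, hUs⟩ := mem_nhdsWithin.1 hev
  obtain ⟨x, hxU, hx⟩ := mem_closure_iff.1 hmem U hU hUt
  obtain ⟨l, u, hlu, hsub⟩ := mem_nhds_iff_exists_Ioo_subset.1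
    ((hU.inter isOpen_Ioo).mem_nhds ⟨hxU, hx⟩)
  obtain ⟨a, ha1, ha2⟩ := exists_rat_btwn hlu.1
  obtain ⟨b, hb1, hb2⟩ := exists_rat_btwn hlu.2
  have ha := hsub ⟨ha1, ha2.trans hlu.2⟩
  have hb := hsub ⟨hlu.1.trans hb1, hb2⟩
  refine ⟨a, b, ha.2.1, ha2.trans hb1, hb.2.2.trans_le (min_le_left _ _),
    hb.2.2.trans_le (min_le_right _ _), |f t| / 2, hpos, fun y hy => ?_⟩
  have hy' := hsub ⟨ha1.trans_le hy.1, hy.2.trans_lt hb2⟩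
  exact le_of_lt (hUs ⟨hy'.1, hy'.2⟩)

/-! ### The scale spectrum of the integral -/

theorem theorem2 {Ω : Type*} [MeasurableSpace Ω] (P : Measure Ω) [IsProbabilityMeasure P]
    -- fractional Brownian motion
    (H : ℝ) (hH : H ∈ Ioo (0 : ℝ) 1) (B : ℝ≥0 → Ω → ℝ) (hB : IsFractionalBrownianMotion H B P)
    -- a process with almost surely Hölder continuous paths of order greater than `1 - H` on `[0, T]`
    (T : ℝ) (hT : 0 < T) (σ : ℝ → Ω → ℝ) (hσm : ∀ t ∈ Icc (0 : ℝ) T, AEMeasurable (σ t) P)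
    (hσ : ∀ᵐ ω ∂P, ∃ α K : ℝ≥0, 1 - H < (α : ℝ) ∧
      HolderOnWith K α (fun t => σ t ω) (Icc (0 : ℝ) T))
    -- the analyzing function, with compact support and at least one vanishing moment
    (ψ : ℝ → ℝ) (hψ : Integrable ψ) (hψs : HasCompactSupport ψ) (hψ0 : ¬ ψ =ᵐ[volume] 0)
    (p : ℕ) (hp : 1 ≤ p) (hψp : HasVanishingMoments ψ p)
    -- the number of initial coefficients
    (N : ℕ) (hN : 1 ≤ N) :
    ∃ C : ℝ → Ω → ℝ, (∀ γ, Measurable (C γ)) ∧ (∀ γ ω, 0 < C γ ω) ∧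
      ∀ᵐ ω ∂P,
        -- the integral and the detail coefficients exist
        (∀ t ∈ Icc (0 : ℝ) T, ∃ I : ℝ,
          IsRiemannStieltjesIntegral (fun s => σ s ω) (fun s => B s.toNNReal ω) 0 t I) ∧
        (∀ j k : ℤ, Integrable fun t : ℝ =>
          ψ ((2 : ℝ) ^ (-j) * t - k) * pathwiseIntegral σ B T t ω) ∧
        -- the upper bound
        (∀ γ < H, ∀ j : ℤ,
          scaleSpectrum ψ (fun t => pathwiseIntegral σ B T t ω) N j
            ≤ C γ ω * (2 : ℝ) ^ ((j : ℝ) * (2 * γ + 1))) ∧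
        -- its failure above `H` and the exponent, unless the path of `σ` is identically zero
        ((∃ t ∈ Icc (0 : ℝ) (min T N), σ t ω ≠ 0) →
          (∀ γ > H, ∀ c : ℝ,
            {j : ℤ | j < 0 ∧
              ¬ scaleSpectrum ψ (fun t => pathwiseIntegral σ B T t ω) N j
                  ≤ c * (2 : ℝ) ^ ((j : ℝ) * (2 * γ + 1))}.Infinite) ∧
          (∀ᶠ j : ℤ in atBot, 0 < scaleSpectrum ψ (fun t => pathwiseIntegral σ B T t ω) N j) ∧
          liminf (fun j : ℤ =>
              ((Real.logb 2 (scaleSpectrum ψ (fun t => pathwiseIntegral σ B T t ω) N j) / (j : ℝ)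
                : ℝ) : EReal)) atBot
            = ((2 * H + 1 : ℝ) : EReal)) := by
  have hN0 : (0 : ℝ) < N := by exact_mod_cast hN
  have hN1 : (1 : ℝ) ≤ N := by exact_mod_cast hN
  obtain ⟨A, hA, hψA⟩ : ∃ A : ℝ, 0 ≤ A ∧ ∀ u, A ≤ |u| → ψ u = 0 := by
    obtain ⟨R, hR⟩ := hψs.isCompact.isBounded.subset_closedBall 0
    refine ⟨|R| + 1, by positivity, fun u hu => ?_⟩
    by_contra hne
    have := hR (subset_tsupport ψ hne)
    rw [mem_closedBall_zero_iff, Real.norm_eq_abs] at this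
    linarith [le_abs_self R]
  have hint0 : ∫ x, ψ x = 0 := by simpa using hψp 0 (by omega)
  have hE := fbmEnergy_pos hH hψ hψA hint0 hψ0
  -- countably many orders `γ n ↑ H` suffice; the bound of order `x < H` follows from that of order
  -- `γ (ν x) > x`, because `S_j` vanishes unless `2 ^ j ≤ N`
  obtain ⟨γ, hγ, hγH⟩ := exists_Ioo_seq hH.1
  have good := ae_exists_isGoodPath hB hH hT hσ hγ hγH
  set κ : ℕ → Ω → ENNReal := fun n ω => ratHolderConst (γ n) fun t => pathwiseIntegral σ B T t ω
  have Im := aemeasurable_pathwiseIntegral hB.gaussian.aemeasurable hT.le hσm good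
  have κm : ∀ n, AEMeasurable (κ n) P := fun n =>
    AEMeasurable.iSup fun q => (((Im _).sub (Im _)).div_const _).enorm
  have hidx : ∀ x : ℝ, ∃ n, x < H → x < γ n := fun x => by
    by_cases hx : x < H
    · exact (hγH x hx).imp fun n hn _ => hn
    · exact ⟨0, fun h => absurd h hx⟩
  choose ν hν using hidx
  set L := ∫ u, |ψ u|
  refine ⟨fun x ω => 1 + (((κm (ν x)).mk _ ω).toReal * A ^ γ (ν x) * L) ^ 2 *
    (N : ℝ) ^ (2 * (γ (ν x) - x)), fun x => ?_, fun x ω => by positivity, ?_⟩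
  · exact ((((((κm (ν x)).measurable_mk).ennreal_toReal).mul_const _).mul_const _).pow_const
      2).mul_const _ |>.const_add 1
  have large : ∀ᵐ ω ∂P, ∀ (a b : ℚ) (i : ℕ), (0 : ℝ) < a →
      ∀ᶠ n : ℕ in atTop, ∃ G ⊆ Finset.Icc ⌈(a : ℝ) * 2 ^ n⌉₊ ⌊(b : ℝ) * 2 ^ n⌋₊,
      (Finset.Icc ⌈(a : ℝ) * 2 ^ n⌉₊ ⌊(b : ℝ) * 2 ^ n⌋₊).card ≤ 2 * G.card ∧ ∀ k ∈ G,
        ((1 / 2 : ℝ) ^ n) ^ (H + 1 / ((i : ℝ) + 1)) ≤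
          |∫ u, ψ u * B ((1 / 2 : ℝ) ^ n * k + (1 / 2 : ℝ) ^ n * u).toNNReal ω| := by
    refine ae_all_iff.2 fun a => ae_all_iff.2 fun b => ae_all_iff.2 fun i => ?_
    by_cases ha : (0 : ℝ) < a
    · filter_upwards [hB.ae_eventually_half_large hH.1 hψ hA hψA hint0 hE ha (b := b)
        (ε := 1 / ((i : ℝ) + 1)) (by positivity)] with ω hω _
      exact hω
    · exact Eventually.of_forall fun ω h => absurd h ha
  filter_upwards [good, large, ae_all_iff.2 fun n => (κm n).ae_eq_mk] with ω ⟨F, hF⟩ hlarge hκ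
  set Z : ℝ → ℝ := fun t => F (min (max t 0) T) with hZ
  have hZeq : (fun t => pathwiseIntegral σ B T t ω) = Z := funext (hF.pathwiseIntegral_eq hT.le)
  have hFc : ContinuousOn F (Icc 0 T) := by
    obtain ⟨K, hK⟩ := hF.holder 0
    exact hK.continuousOn (hγ 0).1
  have hZc : Continuous Z := hFc.comp_continuous (by fun_prop) (clamp_mem hT.le)
  have hup : ∀ x < H, ∀ j : ℤ, scaleSpectrum ψ Z N j ≤
      (1 + (((κm (ν x)).mk _ ω).toReal * A ^ γ (ν x) * L) ^ 2 *
        (N : ℝ) ^ (2 * (γ (ν x) - x))) * (2 : ℝ) ^ ((j : ℝ) * (2 * x + 1)) := by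
    intro x hx j
    set n := ν x
    have hxn : x < γ n := hν x hx
    rcases lt_or_ge (N : ℝ) (2 ^ j) with hj | hj
    · rw [scaleSpectrum_eq_zero hj]; positivity
    obtain ⟨K, hK⟩ := hF.holder n
    have hfin : ratHolderConst (γ n) Z < ⊤ :=
      ratHolderConst_lt_top hK.1 (hK.clamp (hγ n).1.le hT.le)
    have h1 := scaleSpectrum_le_of_holder hψ hψA hint0 hA (hγ n).1.le ENNReal.toReal_nonneg hZc
      (abs_sub_le_ratHolderConst (hγ n).1.le hZc hfin) hN j
    have hκn : (κm n).mk _ ω = ratHolderConst (γ n) Z := by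
      rw [← hκ n, ← hZeq]
    rw [hκn]
    have h2 : (2 : ℝ) ^ ((j : ℝ) * (2 * γ n + 1)) ≤
        (N : ℝ) ^ (2 * (γ n - x)) * (2 : ℝ) ^ ((j : ℝ) * (2 * x + 1)) := by
      rw [show (j : ℝ) * (2 * γ n + 1) = (j : ℝ) * (2 * (γ n - x)) + (j : ℝ) * (2 * x + 1) by ring,
        Real.rpow_add (by norm_num), Real.rpow_mul (by norm_num), Real.rpow_intCast]
      have : 0 ≤ 2 * (γ n - x) := by linarith
      gcongr
    refine h1.trans ((mul_le_mul_of_nonneg_left h2 (sq_nonneg _)).trans ?_)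
    rw [← mul_assoc]
    gcongr
    linarith
  rw [hZeq]
  refine ⟨fun t ht => ⟨F t, hF.isIntegral t ht⟩, fun j k => ?_, hup, fun hne => ?_⟩
  · have h1 : ∀ t, pathwiseIntegral σ B T t ω = Z t := fun t => congrFun hZeq t
    simp_rw [h1]
    have h2 := (integrable_mul_of_continuous hψ hψA (b := fun u =>
      Z ((2 : ℝ) ^ j * k + (2 : ℝ) ^ j * u)) (hZc.comp (by fun_prop))).comp_sub_right (k : ℝ)
    have h3 := h2.comp_mul_left' (R := (2 : ℝ) ^ (-j)) (by positivity)
    refine h3.congr (Eventually.of_forall fun t => ?_)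
    have h4 : (2 : ℝ) ^ j * k + (2 : ℝ) ^ j * ((2 : ℝ) ^ (-j) * t - k) = t := by
      have : (2 : ℝ) ^ j * (2 : ℝ) ^ (-j) = 1 := by
        rw [← zpow_add₀ (by norm_num), add_neg_cancel, zpow_zero]
      linear_combination t * this
    simp only [h4]
  · obtain ⟨a, b, ha, hab, hbT, hbN, m, hm, hfm⟩ :=
      exists_rat_Icc_of_ne_zero hT hN0 hF.continuousOn hne
    refine scaling_of_bounds (fun x hx => ⟨_, by positivity, hup x hx⟩) fun x hx => ?_
    -- a slightly larger order than `H`, below both `x` and `1`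
    obtain ⟨i, hi⟩ := exists_nat_one_div_lt (K := ℝ) (lt_min (sub_pos.2 hx) (sub_pos.2 hH.2))
    have hi1 := hi.trans_le (min_le_left _ _)
    have hi2 := hi.trans_le (min_le_right _ _)
    obtain ⟨C, θ, hθ, hS⟩ := hF.sewing
    obtain ⟨c, hc, hlow⟩ := exists_le_scaleSpectrum (N := N) hψ hψA hint0 hA hN
      (by linarith : H + 1 / ((i : ℝ) + 1) < θ) hS (by linarith) hFc hF.continuous ha hab hbT hbN.le
      hm hfm (hlarge a b i ha)
    refine ⟨c, hc, ?_⟩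
    filter_upwards [hlow, eventually_le_atBot 0] with j hj hj0
    refine le_trans ?_ hj
    have : (j : ℝ) ≤ 0 := by exact_mod_cast hj0
    gcongr c * ?_
    refine Real.rpow_le_rpow_of_exponent_le (by norm_num) ?_
    nlinarith
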